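/- Let $k$ be a field and let $Sm/k$ be the category of smooth separated schemes of finite type over $k$. For a presheaf of abelian groups $\mathcal F$ on $Sm/k$ let $\widetilde C_1\mathcal F$ be the presheaf $X\mapsto\varinjlim_U\mathcal F(U)$, where $U$ runs over the open subschemes $X\times\{0,1\}\subset U\subset X\times\mathbb A^1$, and let $i_0^*,i_1^*:\widetilde C_1\mathcal F\to\mathcal F$ be the restrictions to $X\times 0$ and $X\times 1$. Call $\mathcal F$ rationally contractible if there is a morphism of presheaves $s:\mathcal F\to\widetilde C_1\mathcal F$ with $i_0^*s=0$ and $i_1^*s=1$. Let $\Delta^\ell_k=\operatorname{Spec}k[t_0,\dots,t_\ell]/(t_0+\cdots+t_\ell-1)$ and let $\widehat\Delta^\ell_k$ be its semilocalization at the vertices $v_0,\dots,v_\ell$, so that $\mathcal F(\widehat\Delta^\ell_k)=\varinjlim_{U\ni v_0,\dots,v_\ell}\mathcal F(U)$ over the open $U\subset\Delta^\ell_k$ containing the vertices. Let $\mathcal F(\widehat\Delta^\bullet_k)$ be the chain complex of the simplicial abelian group $\ell\mapsto\mathcal F(\widehat\Delta^\ell_k)$. Shifts are homological: $A[m]_n=A_{n+m}$.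 Let $$\cdots\xrightarrow{d^{-3}}\mathcal F^{-2}\xrightarrow{d^{-2}}\mathcal F^{-1}\xrightarrow{d^{-1}}\mathcal F^0\to 0\to\cdots$$ be a cochain complex of rationally contractible presheaves of abelian groups on $Sm/k$, concentrated in non-positive degrees. Put $\mathcal K^{-n}=\ker d^{-n}$ for $n>0$, $\mathcal L=\operatorname{coker}d^{-1}$, and let $\mathcal H^{-n}$ be the $(-n)$-th cohomology presheaf of $\mathcal F^\bullet$. Then: 1. $\mathcal L(\widehat\Delta^\bullet_k)$ is quasi-isomorphic to $\mathcal K^{-1}(\widehat\Delta^\bullet_k)[-2]$. 2. In the derived category $D(\mathrm{Ab})$ of abelian groups there is a tower of chain complexes whose homology is concentrated in non-negative homological degrees $$\cdots\to\mathcal K^{-3}(\widehat\Delta^\bullet_k)[-2]\to\mathcal K^{-2}(\widehat\Delta^\bullet_k)[-1]\to\mathcal K^{-1}(\widehat\Delta^\bullet_k)$$ whose $q$-th layer, $q\ge 0$, is $\mathcal H^{-1-q}(\widehat\Delta^\bullet_k)[-q]$; that is, for every $q\ge0$ there is a distinguished triangle $$\mathcal K^{-q-2}(\widehat\Delta^\bullet_k)[-q-1]\to\mathcal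 K^{-q-1}(\widehat\Delta^\bullet_k)[-q]\to\mathcal H^{-1-q}(\widehat\Delta^\bullet_k)[-q]\to\mathcal K^{-q-2}(\widehat\Delta^\bullet_k)[-q],$$ where the middle map is induced by the projection $\mathcal K^{-q-1}\to\mathcal H^{-1-q}$. 3. The homological spectral sequence of (the exact couple of) this tower, with differentials $d^r:E^r_{p,q}\to E^r_{p-r,q+r-1}$, $r\ge2$, is a strongly convergent spectral sequence $$E^2_{pq}=H_p\big(\mathcal H^{-1-q}(\tau_{<0}\mathcal F^\bullet)(\widehat\Delta^\bullet_k)\big)\Longrightarrow H_{p+q+2}\big(\mathcal L(\widehat\Delta^\bullet_k)\big),$$ where $\tau_{<0}\mathcal F^\bullet$ is the canonical truncation, whose cohomology presheaves are those of $\mathcal F^\bullet$ in negative degrees and $0$ otherwise. Explicitly, for every $n$ the group $H_{n+2}(\mathcal L(\widehat\Delta^\bullet_k))\cong H_n(\mathcal K^{-1}(\widehat\Delta^\bullet_k))$, the isomorphism being induced by a quasi-isomorphism as in 1, has the finite increasing filtration $F_p$ whose term $F_{n-q}$, $q\ge0$, is the image of $H_n(\mathcal K^{-q-1}(\widehat\Delta^\bullet_k)[-q])$,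 in each bidegree the spectral sequence is stationary from some page on, and $E^\infty_{n-q,q}\cong F_{n-q}/F_{n-q-1}$, by the isomorphism that the tower induces. -/

import Mathlib

open CategoryTheory Limits Opposite AlgebraicGeometry

universe u

noncomputable section

namespace SemilocalEval

variable (k : Type u) [Field k]

/-- The `k`-schemes that are smooth, separated and of finite type. -/
def isSm : ObjectProperty (Over (Spec (CommRingCat.of k))) := fun X =>
  Smooth X.hom ∧ IsSeparated X.hom ∧ LocallyOfFiniteType X.hom ∧ QuasiCompact X.hom

/-- The category `Sm/k` of smooth separated schemes of finite type over the field `k`. -/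
abbrev Sm := (isSm k).FullSubcategory

/-- Presheaves of abelian groups on `Sm/k`. -/
abbrev Psh := (Sm k)ᵒᵖ ⥤ AddCommGrpCat.{u}

variable {k}

/-- The scheme underlying an object of `Sm/k`. -/
abbrev Sm.scheme (X : Sm k) : Scheme.{u} := X.obj.left

/-- The morphism of schemes underlying a morphism of `Sm/k`. -/
abbrev Sm.mor {X Y : Sm k} (f : X ⟶ Y) : X.scheme ⟶ Y.scheme := f.hom.left

lemma Sm.hom_ext {X Y : Sm k} {f g : X ⟶ Y} (h : Sm.mor f = Sm.mor g) : f = g := by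
  ext1; ext1; exact h

lemma Sm.mor_comp {X Y Z : Sm k} (f : X ⟶ Y) (g : Y ⟶ Z) :
    Sm.mor (f ≫ g) = Sm.mor f ≫ Sm.mor g := rfl

/-- Construct a morphism of `Sm/k` from a morphism of `k`-schemes. -/
def Sm.mk {X Y : Sm k} (f : X.scheme ⟶ Y.scheme) (h : f ≫ Y.obj.hom = X.obj.hom) : X ⟶ Y :=
  ObjectProperty.homMk (Over.homMk f h)

lemma isSm_opens (X : Sm k) (U : X.scheme.Opens) : isSm k (Over.mk (U.ι ≫ X.obj.hom)) := by
  obtain ⟨h1, h2, h3, h4⟩ := X.property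
  have : IsLocallyNoetherian X.scheme := LocallyOfFiniteType.isLocallyNoetherian X.obj.hom
  refine ⟨?_, ?_, ?_, ?_⟩ <;> dsimp <;> infer_instance

/-- An open subscheme of an object of `Sm/k`, as an object of `Sm/k`. -/
def Sm.opens (X : Sm k) (U : X.scheme.Opens) : Sm k := ⟨Over.mk (U.ι ≫ X.obj.hom), isSm_opens X U⟩

/-- The restriction `U ⟶ V` of a morphism `f : X ⟶ Y` to open subschemes with `f(U) ⊆ V`. -/
def Sm.res {X Y : Sm k} (f : X ⟶ Y) (U : X.scheme.Opens) (V : Y.scheme.Opens)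
    (h : U ≤ (Sm.mor f) ⁻¹ᵁ V) : X.opens U ⟶ Y.opens V :=
  Sm.mk ((Sm.mor f).resLE V U h) (by
    change (Sm.mor f).resLE V U h ≫ V.ι ≫ Y.obj.hom = U.ι ≫ X.obj.hom
    rw [Scheme.Hom.resLE_comp_ι_assoc]
    exact congrArg _ (Over.w f.hom))

/-- The inclusion of open subschemes of an object of `Sm/k`. -/
def Sm.incl (X : Sm k) {U V : X.scheme.Opens} (h : U ≤ V) : X.opens U ⟶ X.opens V :=
  Sm.mk (X.scheme.homOfLE h) (by
    change X.scheme.homOfLE h ≫ V.ι ≫ X.obj.hom = U.ι ≫ X.obj.hom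
    rw [Scheme.homOfLE_ι_assoc])

lemma Sm.opens_hom_ext {X Y : Sm k} {V : Y.scheme.Opens} {f g : X ⟶ Y.opens V}
    (h : (Sm.mor f : X.scheme ⟶ V.toScheme) ≫ V.ι = (Sm.mor g : X.scheme ⟶ V.toScheme) ≫ V.ι) :
    f = g :=
  Sm.hom_ext ((cancel_mono V.ι).1 h)

lemma Sm.res_comp {X Y Z : Sm k} (f : X ⟶ Y) (g : Y ⟶ Z) (U : X.scheme.Opens)
    (V : Y.scheme.Opens) (W : Z.scheme.Opens) (h : U ≤ (Sm.mor f) ⁻¹ᵁ V)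
    (h' : V ≤ (Sm.mor g) ⁻¹ᵁ W) (h'' : U ≤ (Sm.mor (f ≫ g)) ⁻¹ᵁ W) :
    Sm.res f U V h ≫ Sm.res g V W h' = Sm.res (f ≫ g) U W h'' :=
  Sm.hom_ext (Scheme.Hom.resLE_comp_resLE _ _ _ _)

lemma Sm.res_id {X : Sm k} (U : X.scheme.Opens) (h : U ≤ (Sm.mor (𝟙 X)) ⁻¹ᵁ U) :
    Sm.res (𝟙 X) U U h = 𝟙 _ :=
  Sm.opens_hom_ext (((𝟙 X.scheme : X.scheme ⟶ X.scheme).resLE_comp_ι h).trans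
    ((Category.comp_id _).trans (Category.id_comp _).symm))

lemma Sm.incl_eq {X : Sm k} {U V : X.scheme.Opens} (h : U ≤ V) :
    X.incl h = Sm.res (𝟙 X) U V h :=
  Sm.hom_ext (Scheme.Hom.resLE_id _).symm

lemma Sm.incl_id {X : Sm k} {U : X.scheme.Opens} (h : U ≤ U) : X.incl h = 𝟙 _ := by
  rw [Sm.incl_eq]; exact Sm.res_id _ _

lemma Sm.incl_incl {X : Sm k} {U V W : X.scheme.Opens} (h : U ≤ V) (h' : V ≤ W) :
    X.incl h ≫ X.incl h' = X.incl (h.trans h') :=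
  Sm.hom_ext (Scheme.homOfLE_homOfLE _ h h')

lemma Sm.incl_res {X Y : Sm k} (f : X ⟶ Y) {U' U : X.scheme.Opens} {V : Y.scheme.Opens}
    (i : U' ≤ U) (h : U ≤ (Sm.mor f) ⁻¹ᵁ V) :
    X.incl i ≫ Sm.res f U V h = Sm.res f U' V (i.trans h) :=
  Sm.hom_ext (Scheme.Hom.map_resLE _ h i)

lemma Sm.res_incl {X Y : Sm k} (f : X ⟶ Y) {U : X.scheme.Opens} {V V' : Y.scheme.Opens}
    (h : U ≤ (Sm.mor f) ⁻¹ᵁ V) (i : V ≤ V') (h' : U ≤ (Sm.mor f) ⁻¹ᵁ V') :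
    Sm.res f U V h ≫ Y.incl i = Sm.res f U V' h' :=
  Sm.hom_ext (Scheme.Hom.resLE_map _ h i)

variable (k) in
/-- Pairs `(X, S)` of a scheme `X` in `Sm/k` and a set `S` of points of `X`. -/
structure SmPair where
  /-- the scheme -/
  X : Sm k
  /-- the set of points -/
  S : Set X.scheme

/-- A morphism of pairs `(X, S) ⟶ (Y, T)` is a morphism `f : X ⟶ Y` with `f(S) ⊆ T`. -/
@[ext]
structure SmPair.Hom (P Q : SmPair k) where
  /-- the morphism of schemes -/
  f : P.X ⟶ Q.X
  mapsTo : ∀ x ∈ P.S, Sm.mor f x ∈ Q.S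

instance : Category (SmPair k) where
  Hom := SmPair.Hom
  id P := ⟨𝟙 _, fun _ hx => hx⟩
  comp f g := ⟨f.f ≫ g.f, fun x hx => g.mapsTo _ (f.mapsTo x hx)⟩

/-- The open neighbourhoods `U` of `S` in `X`, ordered by inclusion. -/
abbrev SmPair.Nbhd (P : SmPair k) := { U : P.X.scheme.Opens // ∀ x ∈ P.S, x ∈ U }

/-- The preimage of an open neighbourhood under a morphism of pairs. -/
def SmPair.preimage {P Q : SmPair k} (f : P ⟶ Q) (V : Q.Nbhd) : P.Nbhd :=
  ⟨Sm.mor f.f ⁻¹ᵁ V.1, fun x hx => V.2 _ (f.mapsTo x hx)⟩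

lemma SmPair.preimage_le {P Q : SmPair k} (f : P ⟶ Q) (V : Q.Nbhd) :
    (SmPair.preimage f V).1 ≤ Sm.mor f.f ⁻¹ᵁ V.1 := le_rfl

/-- The diagram of open neighbourhoods of `S` in `X`. -/
def SmPair.diag (P : SmPair k) : P.Nbhd ⥤ Sm k where
  obj U := P.X.opens U.1
  map h := P.X.incl (leOfHom h)
  map_id _ := Sm.incl_id _
  map_comp _ _ := (Sm.incl_incl _ _).symm

/-- `F(X, S) = colim F(U)`, the colimit over all open neighbourhoods `U` of `S` in `X`. -/
def germ (F : Psh k) (P : SmPair k) : AddCommGrpCat.{u} := colimit (P.diag.op ⋙ F)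

/-- The canonical map `F(U) ⟶ F(X, S)`. -/
def toGerm (F : Psh k) (P : SmPair k) (U : P.Nbhd) : F.obj (op (P.X.opens U.1)) ⟶ germ F P :=
  colimit.ι (P.diag.op ⋙ F) (op U)

lemma toGerm_w (F : Psh k) (P : SmPair k) (U V : P.Nbhd) (h : U.1 ≤ V.1) :
    F.map (P.X.incl h).op ≫ toGerm F P U = toGerm F P V :=
  colimit.w (P.diag.op ⋙ F) (homOfLE h : U ⟶ V).op

lemma germ_ext {F : Psh k} {P : SmPair k} {A : AddCommGrpCat.{u}} {f g : germ F P ⟶ A}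
    (h : ∀ U, toGerm F P U ≫ f = toGerm F P U ≫ g) : f = g :=
  colimit.hom_ext fun U => h U.unop

/-- The map out of `F(X, S)` given by a compatible family of maps out of the `F(U)`. -/
def germDesc {F : Psh k} {P : SmPair k} {A : AddCommGrpCat.{u}}
    (φ : ∀ U : P.Nbhd, F.obj (op (P.X.opens U.1)) ⟶ A)
    (h : ∀ (U V : P.Nbhd) (h : U.1 ≤ V.1), F.map (P.X.incl h).op ≫ φ U = φ V) :
    germ F P ⟶ A :=
  colimit.desc (P.diag.op ⋙ F)
    ⟨A, { app := fun U => φ U.unop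
          naturality := fun _ _ i => (h _ _ (leOfHom i.unop)).trans (Category.comp_id _).symm }⟩

lemma toGerm_germDesc {F : Psh k} {P : SmPair k} {A : AddCommGrpCat.{u}}
    (φ : ∀ U : P.Nbhd, F.obj (op (P.X.opens U.1)) ⟶ A)
    (h : ∀ (U V : P.Nbhd) (h : U.1 ≤ V.1), F.map (P.X.incl h).op ≫ φ U = φ V)
    (U : P.Nbhd) : toGerm F P U ≫ germDesc φ h = φ U :=
  colimit.ι_desc _ _

lemma toGerm_germDesc_assoc {F : Psh k} {P : SmPair k} {A A' : AddCommGrpCat.{u}}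
    (φ : ∀ U : P.Nbhd, F.obj (op (P.X.opens U.1)) ⟶ A)
    (h : ∀ (U V : P.Nbhd) (h : U.1 ≤ V.1), F.map (P.X.incl h).op ≫ φ U = φ V)
    (U : P.Nbhd) (g : A ⟶ A') : toGerm F P U ≫ germDesc φ h ≫ g = φ U ≫ g := by
  rw [← Category.assoc, toGerm_germDesc]

/-- Pullback of germs along a morphism of pairs, induced by `F(V) ⟶ F(f⁻¹(V))`. -/
def germMap (F : Psh k) {P Q : SmPair k} (f : P ⟶ Q) : germ F Q ⟶ germ F P :=
  germDesc (fun V => F.map (Sm.res f.f (SmPair.preimage f V).1 V.1 (SmPair.preimage_le f V)).op ≫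
      toGerm F P (SmPair.preimage f V))
    (fun U V h => by
      have hle : (SmPair.preimage f U).1 ≤ (SmPair.preimage f V).1 := fun x hx => h hx
      rw [← toGerm_w F P _ _ hle, ← F.map_comp_assoc, ← F.map_comp_assoc, ← op_comp, ← op_comp,
        Sm.incl_res, Sm.res_incl])

lemma toGerm_germMap (F : Psh k) {P Q : SmPair k} (f : P ⟶ Q) (U : P.Nbhd) (V : Q.Nbhd)
    (h : U.1 ≤ (Sm.mor f.f) ⁻¹ᵁ V.1) :
    toGerm F Q V ≫ germMap F f = F.map (Sm.res f.f U.1 V.1 h).op ≫ toGerm F P U := by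
  have hle : U.1 ≤ (SmPair.preimage f V).1 := h
  rw [germMap, toGerm_germDesc, ← toGerm_w F P _ _ hle, ← F.map_comp_assoc, ← op_comp, Sm.incl_res]

lemma toGerm_germMap_assoc (F : Psh k) {P Q : SmPair k} (f : P ⟶ Q) (U : P.Nbhd) (V : Q.Nbhd)
    (h : U.1 ≤ (Sm.mor f.f) ⁻¹ᵁ V.1) {A : AddCommGrpCat.{u}} (g : germ F P ⟶ A) :
    toGerm F Q V ≫ germMap F f ≫ g =
      F.map (Sm.res f.f U.1 V.1 h).op ≫ toGerm F P U ≫ g := by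
  rw [← Category.assoc, toGerm_germMap F f U V h, Category.assoc]

lemma germMap_id (F : Psh k) (P : SmPair k) : germMap F (𝟙 P) = 𝟙 _ := by
  refine germ_ext fun U => ?_
  rw [toGerm_germMap F (𝟙 P) U U le_rfl, Category.comp_id]
  exact (congrArg (· ≫ toGerm F P U)
    ((congrArg (fun f => F.map f.op) (Sm.res_id U.1 _)).trans (F.map_id _))).trans
      (Category.id_comp _)

lemma germMap_comp (F : Psh k) {P Q R : SmPair k} (f : P ⟶ Q) (g : Q ⟶ R) :
    germMap F (f ≫ g) = germMap F g ≫ germMap F f := by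
  refine germ_ext fun U => ?_
  rw [toGerm_germMap F (f ≫ g) (SmPair.preimage f (SmPair.preimage g U)) U
      ((SmPair.preimage_le f _).trans fun _ hx => hx),
    toGerm_germMap_assoc F g (SmPair.preimage g U) U (SmPair.preimage_le g U),
    toGerm_germMap F f (SmPair.preimage f (SmPair.preimage g U)) (SmPair.preimage g U)
      (SmPair.preimage_le f _),
    ← F.map_comp_assoc, ← op_comp, Sm.res_comp]
  rfl

/-- The map on germs induced by a morphism of presheaves. -/
def germTrans {F G : Psh k} (η : F ⟶ G) (P : SmPair k) : germ F P ⟶ germ G P :=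
  germDesc (fun U => η.app _ ≫ toGerm G P U) (fun U V h => by
    rw [← toGerm_w G P U V h, NatTrans.naturality_assoc])

lemma toGerm_germTrans {F G : Psh k} (η : F ⟶ G) (P : SmPair k) (U : P.Nbhd) :
    toGerm F P U ≫ germTrans η P = η.app _ ≫ toGerm G P U :=
  toGerm_germDesc _ _ _

lemma toGerm_germTrans_assoc {F G : Psh k} (η : F ⟶ G) (P : SmPair k) (U : P.Nbhd)
    {A : AddCommGrpCat.{u}} (g : germ G P ⟶ A) :
    toGerm F P U ≫ germTrans η P ≫ g = η.app _ ≫ toGerm G P U ≫ g := by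
  rw [← Category.assoc, toGerm_germTrans, Category.assoc]

variable (k) in
/-- The functor sending a presheaf `F` to the presheaf `(X, S) ↦ F(X, S)` on pairs. -/
def germFunctor : Psh k ⥤ (SmPair k)ᵒᵖ ⥤ AddCommGrpCat.{u} where
  obj F :=
    { obj := fun P => germ F P.unop
      map := fun f => germMap F f.unop
      map_id := fun _ => germMap_id _ _
      map_comp := fun _ _ => germMap_comp _ _ _ }
  map η :=
    { app := fun P => germTrans η P.unop
      naturality := fun P Q f => germ_ext fun U => by
        dsimp
        rw [toGerm_germMap_assoc _ _ (SmPair.preimage f.unop U) U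
          (SmPair.preimage_le f.unop U), toGerm_germTrans,
          toGerm_germTrans_assoc, toGerm_germMap _ _ (SmPair.preimage f.unop U) U
          (SmPair.preimage_le f.unop U),
          NatTrans.naturality_assoc] }
  map_id F := by
    ext P : 2
    refine germ_ext fun U => ?_
    dsimp
    rw [toGerm_germTrans]; simp
  map_comp η θ := by
    ext P : 2
    refine germ_ext fun U => ?_
    dsimp
    rw [toGerm_germTrans, toGerm_germTrans_assoc, toGerm_germTrans]; simp


/-! ### Rationally contractible presheaves -/

instance smooth_affineSpace (n : Type u) [Finite n] (S : Scheme.{u}) : Smooth (𝔸(n; S) ↘ S) := by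
  have : MorphismProperty.RespectsIso (@Smooth.{u}) :=
    MorphismProperty.IsStableUnderBaseChange.respectsIso
  have hZ : Smooth (𝔸(n; Spec (CommRingCat.of (ULift.{u} ℤ))) ↘
      Spec (CommRingCat.of (ULift.{u} ℤ))) := by
    rw [← MorphismProperty.cancel_left_of_respectsIso @Smooth.{u}
      (AffineSpace.SpecIso n (CommRingCat.of (ULift.{u} ℤ))).inv, AffineSpace.SpecIso_inv_over,
      HasRingHomProperty.Spec_iff (P := @Smooth)]
    change (MvPolynomial.C : ULift.{u} ℤ →+* MvPolynomial n (ULift.{u} ℤ)).Smooth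
    rw [← MvPolynomial.algebraMap_eq, RingHom.smooth_algebraMap]
    exact ⟨inferInstance, inferInstance⟩
  exact MorphismProperty.of_isPullback (P := @Smooth)
    (AffineSpace.isPullback_map (n := n) (specULiftZIsTerminal.from S)) hZ

lemma isSm_A1 (X : Sm k) :
    isSm k (Over.mk (𝔸(PUnit.{u + 1}; X.scheme) ↘ X.scheme ≫ X.obj.hom)) := by
  obtain ⟨h1, h2, h3, h4⟩ := X.property
  refine ⟨?_, ?_, ?_, ?_⟩ <;> dsimp <;> infer_instance

/-- The product `X × 𝔸¹`. -/
def Sm.A1 (X : Sm k) : Sm k := ⟨Over.mk (𝔸(PUnit.{u + 1}; X.scheme) ↘ X.scheme ≫ X.obj.hom), isSm_A1 X⟩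

/-- The morphism `f × 𝔸¹ : X × 𝔸¹ ⟶ Y × 𝔸¹`. -/
def Sm.A1map {X Y : Sm k} (f : X ⟶ Y) : X.A1 ⟶ Y.A1 :=
  Sm.mk (AffineSpace.map PUnit.{u + 1} (Sm.mor f)) (by
    change AffineSpace.map PUnit.{u + 1} (Sm.mor f) ≫ 𝔸(PUnit.{u + 1}; Y.scheme) ↘ Y.scheme ≫
      Y.obj.hom = 𝔸(PUnit.{u + 1}; X.scheme) ↘ X.scheme ≫ X.obj.hom
    rw [AffineSpace.map_over_assoc]
    exact congrArg _ (Over.w f.hom))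

/-- The section `X ⟶ X × 𝔸¹`, `x ↦ (x, c)`, at the rational point `c` of the affine line
(used for `c = 0, 1`). -/
def Sm.sec (X : Sm k) (c : ℕ) : X ⟶ X.A1 :=
  Sm.mk (AffineSpace.homOfVector (𝟙 X.scheme) fun _ => (c : Γ(X.scheme, ⊤))) (by
    change _ ≫ 𝔸(PUnit.{u + 1}; X.scheme) ↘ X.scheme ≫ X.obj.hom = X.obj.hom
    rw [AffineSpace.homOfVector_over_assoc, Category.id_comp])

lemma Sm.sec_A1map {X Y : Sm k} (f : X ⟶ Y) (c : ℕ) : X.sec c ≫ Sm.A1map f = f ≫ Y.sec c := by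
  apply Sm.hom_ext
  change AffineSpace.homOfVector (𝟙 X.scheme) (fun _ => (c : Γ(X.scheme, ⊤))) ≫
    AffineSpace.map PUnit.{u + 1} (Sm.mor f) = Sm.mor f ≫
      AffineSpace.homOfVector (𝟙 Y.scheme) (fun _ => (c : Γ(Y.scheme, ⊤)))
  apply AffineSpace.hom_ext
  · simp
  · intro i
    rw [Scheme.Hom.comp_appTop, Scheme.Hom.comp_appTop, CommRingCat.comp_apply,
      CommRingCat.comp_apply, AffineSpace.map_appTop_coord, AffineSpace.homOfVector_appTop_coord,
      AffineSpace.homOfVector_appTop_coord, map_natCast]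

variable (k) in
/-- The functor `X ↦ (X × 𝔸¹, X × {0, 1})`. -/
def cyl : Sm k ⥤ SmPair k where
  obj X := ⟨X.A1, Set.range (Sm.mor (X.sec 0)) ∪ Set.range (Sm.mor (X.sec 1))⟩
  map {X Y} f := ⟨Sm.A1map f, by
    have key : ∀ c x, Sm.mor (Sm.A1map f) (Sm.mor (X.sec c) x) = Sm.mor (Y.sec c) (Sm.mor f x) := by
      intro c x
      have := congrArg (fun g => Sm.mor g x) (Sm.sec_A1map f c)
      simpa [Sm.mor_comp] using this
    rintro _ (⟨x, rfl⟩ | ⟨x, rfl⟩)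
    · exact Or.inl ⟨_, (key 0 x).symm⟩
    · exact Or.inr ⟨_, (key 1 x).symm⟩⟩
  map_id X := SmPair.Hom.ext (Sm.hom_ext (AffineSpace.map_id _))
  map_comp f g := SmPair.Hom.ext (Sm.hom_ext (AffineSpace.map_comp _ _))

/-- The presheaf `C̃₁F`, with `C̃₁F(X) = colim F(U)`, the colimit over all open neighbourhoods `U`
of `X × {0, 1}` in `X × 𝔸¹`. -/
def C1 (F : Psh k) : Psh k := (cyl k).op ⋙ (germFunctor k).obj F

/-- The factorization through the open subscheme `V` of a morphism `f` with image in `V`. -/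
def liftOpens {X Y : Scheme.{u}} (f : X ⟶ Y) (V : Y.Opens) (h : ∀ x, f x ∈ V) : X ⟶ V.toScheme :=
  IsOpenImmersion.lift V.ι f (by rintro _ ⟨x, rfl⟩; simpa using h x)

lemma liftOpens_ι {X Y : Scheme.{u}} (f : X ⟶ Y) (V : Y.Opens) (h : ∀ x, f x ∈ V) :
    liftOpens f V h ≫ V.ι = f :=
  IsOpenImmersion.lift_fac _ _ _

lemma liftOpens_ι_assoc {X Y Z : Scheme.{u}} (f : X ⟶ Y) (V : Y.Opens) (h : ∀ x, f x ∈ V)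
    (g : Y ⟶ Z) : liftOpens f V h ≫ V.ι ≫ g = f ≫ g := by
  rw [← Category.assoc, liftOpens_ι]

/-- The factorization `X ⟶ V` of a morphism `f : X ⟶ Y` with image in the open subscheme `V`. -/
def Sm.lift {X Y : Sm k} (f : X ⟶ Y) (V : Y.scheme.Opens) (h : ∀ x, Sm.mor f x ∈ V) :
    X ⟶ Y.opens V :=
  Sm.mk (Y := Y.opens V) (liftOpens (Sm.mor f) V h)
    ((liftOpens_ι_assoc (Sm.mor f) V h Y.obj.hom).trans (Over.w f.hom))

lemma Sm.mor_lift {X Y : Sm k} (f : X ⟶ Y) (V : Y.scheme.Opens) (h : ∀ x, Sm.mor f x ∈ V) :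
    Sm.mor (Sm.lift f V h) = liftOpens (Sm.mor f) V h := rfl

lemma Sm.lift_incl {X Y : Sm k} (f : X ⟶ Y) {V W : Y.scheme.Opens} (i : V ≤ W)
    (h : ∀ x, Sm.mor f x ∈ V) : Sm.lift f V h ≫ Y.incl i = Sm.lift f W fun x => i (h x) := by
  have key : (liftOpens (Sm.mor f) V h ≫ Y.scheme.homOfLE i) ≫ W.ι =
      liftOpens (Sm.mor f) W (fun x => i (h x)) ≫ W.ι := by
    rw [Category.assoc, Scheme.homOfLE_ι, liftOpens_ι, liftOpens_ι]
  exact Sm.opens_hom_ext key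

lemma Sm.lift_res {X X' Y Y' : Sm k} (f : X ⟶ Y) (f' : X' ⟶ Y') (a : X' ⟶ X) (b : Y' ⟶ Y)
    (w : f' ≫ b = a ≫ f) (U : Y'.scheme.Opens) (V : Y.scheme.Opens) (hU : ∀ x, Sm.mor f' x ∈ U)
    (hV : ∀ x, Sm.mor f x ∈ V) (h : U ≤ Sm.mor b ⁻¹ᵁ V) :
    Sm.lift f' U hU ≫ Sm.res b U V h = a ≫ Sm.lift f V hV := by
  have key : (liftOpens (Sm.mor f') U hU ≫ (Sm.mor b).resLE V U h) ≫ V.ι =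
      (Sm.mor a ≫ liftOpens (Sm.mor f) V hV) ≫ V.ι := by
    rw [Category.assoc, Scheme.Hom.resLE_comp_ι, Category.assoc, liftOpens_ι, liftOpens_ι_assoc]
    exact congrArg Sm.mor w
  exact Sm.opens_hom_ext key

/-- The section `X = X × {c} ⟶ X × 𝔸¹`, `c = 0, 1`. -/
def cylSec (X : Sm k) (c : Fin 2) : X ⟶ ((cyl k).obj X).X := X.sec c.val

lemma cylSec_mem (X : Sm k) (c : Fin 2) (x : X.scheme) :
    Sm.mor (cylSec X c) x ∈ ((cyl k).obj X).S := by
  fin_cases c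
  · exact Or.inl ⟨x, rfl⟩
  · exact Or.inr ⟨x, rfl⟩

/-- The restriction `C̃₁F(X) ⟶ F(X)` to `X × {c}`, `c = 0, 1`: on the term `F(U)` of the colimit
it is pullback along the section `X = X × {c} ⟶ U`. -/
def iStarApp (F : Psh k) (c : Fin 2) (X : Sm k) : germ F ((cyl k).obj X) ⟶ F.obj (op X) :=
  germDesc (fun U => F.map (Sm.lift (cylSec X c) U.1 fun x => U.2 _ (cylSec_mem _ c x)).op)
    (fun U V h => by rw [← F.map_comp, ← op_comp, Sm.lift_incl])

lemma iStarApp_naturality (F : Psh k) (c : Fin 2) {X Y : Sm k} (f : Y ⟶ X) :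
    germMap F ((cyl k).map f) ≫ iStarApp F c Y = iStarApp F c X ≫ F.map f.op := by
  refine germ_ext fun V => ?_
  rw [toGerm_germMap_assoc F ((cyl k).map f) (SmPair.preimage _ V) V (SmPair.preimage_le _ V),
    iStarApp, iStarApp, toGerm_germDesc, toGerm_germDesc_assoc, ← F.map_comp, ← F.map_comp,
    ← op_comp, ← op_comp]
  congr 2
  exact Sm.lift_res (cylSec X c) (cylSec Y c) f ((cyl k).map f).f (Sm.sec_A1map f c.val) _ _ _ _ _

/-- The morphism of presheaves `i_c^* : C̃₁F ⟶ F`, `c = 0, 1`. -/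
def iStar (F : Psh k) (c : Fin 2) : C1 F ⟶ F where
  app X := iStarApp F c X.unop
  naturality _ _ f := iStarApp_naturality F c f.unop

/-- A presheaf `F` is rationally contractible if there is a morphism of presheaves `s : F ⟶ C̃₁F`
with `i_0^* s = 0` and `i_1^* s = 1`. -/
def RationallyContractible (F : Psh k) : Prop :=
  ∃ s : F ⟶ C1 F, s ≫ iStar F 0 = 0 ∧ s ≫ iStar F 1 = 𝟙 F

/-! ### The semilocal simplices -/

variable (k) in
/-- The ring `k[t₀, …, tₙ] / (t₀ + ⋯ + tₙ - 1)`. -/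
abbrev SimplexRing (n : ℕ) : Type u :=
  MvPolynomial (Fin (n + 1)) k ⧸
    Ideal.span {(∑ i, MvPolynomial.X i - 1 : MvPolynomial (Fin (n + 1)) k)}

/-- The `k`-algebra map out of the simplex ring given by elements `a i` with sum `1`. -/
def SimplexRing.lift {n : ℕ} {A : Type u} [CommRing A] [Algebra k A] (a : Fin (n + 1) → A)
    (ha : ∑ i, a i = 1) : SimplexRing k n →ₐ[k] A :=
  Ideal.Quotient.liftₐ _ (MvPolynomial.aeval a) (by
    intro x hx
    have : Ideal.span {(∑ i, MvPolynomial.X i - 1 : MvPolynomial (Fin (n + 1)) k)} ≤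
        RingHom.ker (MvPolynomial.aeval (R := k) a) := by
      rw [Ideal.span_singleton_le_iff_mem]
      simp [RingHom.mem_ker, ha]
    exact this hx)

/-- The barycentric coordinate `tᵢ`. -/
def SimplexRing.t {n : ℕ} (i : Fin (n + 1)) : SimplexRing k n :=
  Ideal.Quotient.mk _ (MvPolynomial.X i)

lemma SimplexRing.lift_t {n : ℕ} {A : Type u} [CommRing A] [Algebra k A] (a : Fin (n + 1) → A)
    (ha : ∑ i, a i = 1) (i : Fin (n + 1)) : SimplexRing.lift (k := k) a ha (SimplexRing.t i) = a i := by
  exact MvPolynomial.aeval_X a i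

lemma SimplexRing.sum_t (n : ℕ) : ∑ i, (SimplexRing.t i : SimplexRing k n) = 1 := by
  have h : Ideal.Quotient.mk (Ideal.span {(∑ i, MvPolynomial.X i - 1 :
      MvPolynomial (Fin (n + 1)) k)}) (∑ i, MvPolynomial.X i - 1) = 0 :=
    Ideal.Quotient.eq_zero_iff_mem.2 (Ideal.mem_span_singleton_self _)
  rw [map_sub, sub_eq_zero, map_sum, map_one] at h
  exact h

lemma SimplexRing.hom_ext {n : ℕ} {A : Type u} [CommRing A] [Algebra k A]
    {f g : SimplexRing k n →ₐ[k] A} (h : ∀ i, f (SimplexRing.t i) = g (SimplexRing.t i)) : f = g := by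
  apply Ideal.Quotient.algHom_ext
  apply MvPolynomial.algHom_ext
  exact h

/-- The simplex ring is a polynomial ring in `n` variables. -/
def SimplexRing.equiv (n : ℕ) : MvPolynomial (Fin n) k ≃ₐ[k] SimplexRing k n :=
  AlgEquiv.ofAlgHom (MvPolynomial.aeval fun i => SimplexRing.t i.succ)
    (SimplexRing.lift (Fin.cons (1 - ∑ i, MvPolynomial.X i) MvPolynomial.X)
      (by simp [Fin.sum_univ_succ]))
    (SimplexRing.hom_ext fun i => by
      rw [AlgHom.comp_apply, SimplexRing.lift_t]
      refine Fin.cases ?_ (fun j => ?_) i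
      · have h := SimplexRing.sum_t (k := k) n
        rw [Fin.sum_univ_succ] at h
        simp [← h]
      · simp)
    (MvPolynomial.algHom_ext fun i => by
      rw [AlgHom.comp_apply, MvPolynomial.aeval_X, SimplexRing.lift_t]
      simp)

instance (n : ℕ) : Algebra.Smooth k (SimplexRing k n) :=
  haveI : Algebra.Smooth k (MvPolynomial (Fin n) k) := ⟨inferInstance, inferInstance⟩
  Algebra.Smooth.of_equiv (SimplexRing.equiv n)

variable (k) in
/-- The standard simplex `Δⁿ = Spec k[t₀, …, tₙ] / (t₀ + ⋯ + tₙ - 1)`, as an object of `Sm/k`. -/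
def simplex (n : ℕ) : Sm k :=
  ⟨Over.mk (Spec.map (CommRingCat.ofHom (algebraMap k (SimplexRing k n)))), by
    refine ⟨?_, ?_, ?_, ?_⟩
    · dsimp
      rw [HasRingHomProperty.Spec_iff (P := @Smooth)]
      change (algebraMap k (SimplexRing k n)).Smooth
      rw [RingHom.smooth_algebraMap]
      infer_instance
    · dsimp
      infer_instance
    · dsimp
      rw [HasRingHomProperty.Spec_iff (P := @LocallyOfFiniteType)]
      change (algebraMap k (SimplexRing k n)).FiniteType
      rw [RingHom.finiteType_algebraMap]
      infer_instance
    · dsimp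
      infer_instance⟩

/-- The morphism of simplices given by an algebra map. -/
def simplexMk {m n : ℕ} (φ : SimplexRing k n →ₐ[k] SimplexRing k m) : simplex k m ⟶ simplex k n :=
  Sm.mk (Spec.map (CommRingCat.ofHom φ.toRingHom)) (by
    change Spec.map (CommRingCat.ofHom φ.toRingHom) ≫
      Spec.map (CommRingCat.ofHom (algebraMap k (SimplexRing k n))) =
      Spec.map (CommRingCat.ofHom (algebraMap k (SimplexRing k m)))
    rw [← Spec.map_comp, ← CommRingCat.ofHom_comp]
    congr 2
    exact φ.comp_algebraMap)

/-- The algebra map `tⱼ ↦ ∑_{θ(i) = j} tᵢ` induced by a map of vertices `θ`. -/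
def SimplexRing.map {m n : ℕ} (θ : Fin (m + 1) → Fin (n + 1)) : SimplexRing k n →ₐ[k] SimplexRing k m :=
  SimplexRing.lift (fun j => ∑ i with θ i = j, SimplexRing.t i) (by
    rw [Finset.sum_fiberwise, SimplexRing.sum_t])

lemma SimplexRing.map_t {m n : ℕ} (θ : Fin (m + 1) → Fin (n + 1)) (j : Fin (n + 1)) :
    SimplexRing.map (k := k) θ (SimplexRing.t j) = ∑ i with θ i = j, SimplexRing.t i :=
  SimplexRing.lift_t _ _ _

/-- The `k`-point evaluation `tⱼ ↦ δᵢⱼ` at the `i`-th vertex. -/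
def SimplexRing.eval {n : ℕ} (i : Fin (n + 1)) : SimplexRing k n →ₐ[k] k :=
  SimplexRing.lift (fun j => if i = j then 1 else 0) (by simp)

/-- The `i`-th vertex `vᵢ` of `Δⁿ`: the closed point whose maximal ideal is the kernel of the
evaluation `tⱼ ↦ δᵢⱼ`. -/
def vertex {n : ℕ} (i : Fin (n + 1)) : (simplex k n).scheme :=
  (⟨RingHom.ker (SimplexRing.eval (k := k) i), RingHom.ker_isPrime _⟩ :
    PrimeSpectrum (SimplexRing k n))

lemma SimplexRing.map_id (n : ℕ) : SimplexRing.map (k := k) (id : Fin (n + 1) → _) = AlgHom.id k _ := by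
  apply SimplexRing.hom_ext
  intro j
  rw [SimplexRing.map_t]
  simp [Finset.filter_eq']

lemma SimplexRing.map_comp {l m n : ℕ} (θ : Fin (l + 1) → Fin (m + 1))
    (η : Fin (m + 1) → Fin (n + 1)) :
    (SimplexRing.map (k := k) θ).comp (SimplexRing.map η) = SimplexRing.map (η ∘ θ) := by
  apply SimplexRing.hom_ext
  intro j
  rw [AlgHom.comp_apply, SimplexRing.map_t, SimplexRing.map_t, map_sum]
  simp_rw [SimplexRing.map_t]
  rw [Finset.sum_comm' (t' := Finset.univ.filter fun i => η (θ i) = j) (s' := fun i => {θ i})]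
  · simp
  · intro x y; simp; grind

lemma SimplexRing.eval_map {m n : ℕ} (θ : Fin (m + 1) → Fin (n + 1)) (i : Fin (m + 1)) :
    (SimplexRing.eval (k := k) i).comp (SimplexRing.map θ) = SimplexRing.eval (θ i) := by
  apply SimplexRing.hom_ext
  intro j
  rw [AlgHom.comp_apply, SimplexRing.map_t, map_sum]
  simp only [SimplexRing.eval, SimplexRing.lift_t]
  simp [Finset.sum_ite_eq]

lemma simplexMk_vertex {m n : ℕ} (θ : Fin (m + 1) → Fin (n + 1)) (i : Fin (m + 1)) :
    Sm.mor (simplexMk (SimplexRing.map (k := k) θ)) (vertex i) = vertex (θ i) := by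
  refine PrimeSpectrum.ext (Ideal.ext fun x => ?_)
  change SimplexRing.eval i (SimplexRing.map θ x) = 0 ↔ SimplexRing.eval (θ i) x = 0
  rw [← SimplexRing.eval_map]
  rfl

variable (k) in
/-- The cosimplicial pair `n ↦ (Δⁿ, {v₀, …, vₙ})`; evaluating presheaves at this pair is evaluating
them at the semilocalization of `Δⁿ` at its vertices. -/
def semilocalSimplex : SimplexCategory ⥤ SmPair k where
  obj n := ⟨simplex k n.len, Set.range vertex⟩
  map θ := ⟨simplexMk (SimplexRing.map θ.toOrderHom), by
    rintro _ ⟨i, rfl⟩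
    exact ⟨_, (simplexMk_vertex _ i).symm⟩⟩
  map_id n := SmPair.Hom.ext (Sm.hom_ext (by
    change Spec.map (CommRingCat.ofHom (SimplexRing.map (k := k) id).toRingHom) = 𝟙 _
    rw [SimplexRing.map_id]
    exact Spec.map_id _))
  map_comp θ η := SmPair.Hom.ext (Sm.hom_ext (by
    change Spec.map (CommRingCat.ofHom (SimplexRing.map (k := k)
      (η.toOrderHom ∘ θ.toOrderHom)).toRingHom) =
        Spec.map (CommRingCat.ofHom (SimplexRing.map (k := k) θ.toOrderHom).toRingHom) ≫
        Spec.map (CommRingCat.ofHom (SimplexRing.map (k := k) η.toOrderHom).toRingHom)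
    rw [← SimplexRing.map_comp, ← Spec.map_comp, ← CommRingCat.ofHom_comp]
    rfl))

/-! ### The chain complexes `F(Δ̂•)` and the derived category -/

variable (k) in
/-- The functor sending a presheaf `F` to the chain complex `F(Δ̂•)` of the simplicial abelian group
`n ↦ F(Δ̂ⁿ)`, with differential the alternating sum of the faces. -/
def semilocalEval : Psh k ⥤ ChainComplex AddCommGrpCat.{u} ℕ :=
  germFunctor k ⋙ (Functor.whiskeringLeft _ _ _).obj (semilocalSimplex k).op ⋙
    AlgebraicTopology.alternatingFaceMapComplex _

/-- A chain complex `A` as a cochain complex, `A n` being placed in cohomological degree `-n`. -/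
def toCochain : ChainComplex AddCommGrpCat.{u} ℕ ⥤ CochainComplex AddCommGrpCat.{u} ℤ :=
  ComplexShape.embeddingDownNat.extendFunctor _

/-- The homology group `Hₙ(A)`, for `n : ℤ` (it vanishes for `n < 0`). -/
def chainHomology (A : ChainComplex AddCommGrpCat.{u} ℕ) (n : ℤ) : AddCommGrpCat.{u} :=
  (toCochain.obj A).homology (-n)

instance hasDerivedCategoryAb : HasDerivedCategory.{u + 1} AddCommGrpCat.{u} :=
  HasDerivedCategory.standard _

/-- The derived category `D(Ab)`. Its shift functor is cohomological: `X⟦n⟧` is the homological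
shift `X[-n]`. -/
abbrev DAb := DerivedCategory AddCommGrpCat.{u}

/-- The object of `D(Ab)` defined by a chain complex. -/
def toD : ChainComplex AddCommGrpCat.{u} ℕ ⥤ DAb.{u} := toCochain ⋙ DerivedCategory.Q

/-- The `n`-th homology group `Hₙ(X) = H⁻ⁿ(X)` of an object of `D(Ab)`. -/
abbrev hD (n : ℤ) (X : DAb.{u}) : AddCommGrpCat.{u} :=
  (DerivedCategory.homologyFunctor AddCommGrpCat.{u} (-n)).obj X

/-! ### Towers and their spectral sequences -/

/-- A tower `⋯ ⟶ T 2 ⟶ T 1 ⟶ T 0` in `D(Ab)` with layers `G 0, G 1, …`: there are distinguished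
triangles `T (q + 1) ⟶ T q ⟶ G q ⟶ T (q + 1)⟦1⟧`. -/
structure Tower (T G : ℕ → DAb.{u}) where
  /-- the structure maps of the tower -/
  α (q : ℕ) : T (q + 1) ⟶ T q
  /-- the projections to the layers -/
  proj (q : ℕ) : T q ⟶ G q
  /-- the connecting maps -/
  conn (q : ℕ) : G q ⟶ (T (q + 1))⟦(1 : ℤ)⟧
  distinguished (q : ℕ) : Pretriangulated.Triangle.mk (α q) (proj q) (conn q) ∈
    Pretriangulated.distinguishedTriangles

namespace Tower

variable {T G : ℕ → DAb.{u}} (t : Tower T G)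

/-- The composite structure map `T b ⟶ T a` of the tower, for `a ≤ b`. -/
def trans {a b : ℕ} (h : a ≤ b) : T b ⟶ T a := (Functor.ofOpSequence t.α).map (homOfLE h).op

/-- The map `Hₙ(T b) ⟶ Hₙ(T a)`, for `a ≤ b`. -/
def i (n : ℤ) {a b : ℕ} (h : a ≤ b) : hD n (T b) ⟶ hD n (T a) :=
  (DerivedCategory.homologyFunctor _ (-n)).map (t.trans h)

/-- The map `Hₙ(T q) ⟶ Hₙ(G q)`. -/
def j (n : ℤ) (q : ℕ) : hD n (T q) ⟶ hD n (G q) :=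
  (DerivedCategory.homologyFunctor _ (-n)).map (t.proj q)

/-- The connecting homomorphism `Hₙ(G q) ⟶ Hₙ₋₁(T (q + 1))`. -/
def δ (n : ℤ) (q : ℕ) : hD n (G q) ⟶ hD (n - 1) (T (q + 1)) :=
  DerivedCategory.HomologySequence.δ
    (Pretriangulated.Triangle.mk (t.α q) (t.proj q) (t.conn q)) (-n) (-(n - 1)) (by ring)

/-- The classes in `Hₙ(G q)` that survive to the page `E^{2 + s}`: those whose image in
`Hₙ₋₁(T (q + 1))` lifts to `Hₙ₋₁(T (q + 1 + s))`. -/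
def Z (s : ℕ) (n : ℤ) (q : ℕ) : AddSubgroup (hD n (G q)) :=
  (t.i (n - 1) (Nat.le_add_right (q + 1) s)).hom.range.comap (t.δ n q).hom

/-- The classes in `Hₙ(G q)` that are zero in the page `E^{2 + s}`: the images of the classes in
`Hₙ(T q)` that die in `Hₙ(T (q - s))`, where `T (q - s)` means `T 0` if `q < s`. -/
def B (s : ℕ) (n : ℤ) (q : ℕ) : AddSubgroup (hD n (G q)) :=
  (t.i n (Nat.sub_le q s)).hom.ker.map (t.j n q).hom

end Tower

/-- Homological spectral sequences of abelian groups starting with the page `E²`, with differentials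
`dʳ : Eʳ_{p,q} ⟶ Eʳ_{p-r,q+r-1}`. -/
abbrev E2SpectralSequence :=
  SpectralSequence AddCommGrpCat.{u} (fun r => ComplexShape.up' ((-r, r - 1) : ℤ × ℤ)) 2

/-- The datum exhibiting `E` as the spectral sequence of the tower `t`, i.e. of the exact couple
formed by the groups `Hₙ(T q)` and `Hₙ(G q)`, the latter placed in bidegree `(n - q, q)` of `E²`:
identifications `Eʳ_{n-q,q} = Zʳ / Bʳ` such that `dʳ[x] = [j y]` whenever `y` lifts `δ x`, and such
that the identification of the homology of a page with the next page is the obvious one. -/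
structure Tower.SpectralSequenceData {T G : ℕ → DAb.{u}} (t : Tower T G)
    (E : E2SpectralSequence.{u}) where
  /-- the class in `Eʳ`, `r = 2 + s`, of an element of `Zʳ` -/
  cls (s : ℕ) (n : ℤ) (q : ℕ) : t.Z s n q →+ (E.page (2 + s)).X (n - q, q)
  cls_surjective (s : ℕ) (n : ℤ) (q : ℕ) : Function.Surjective (cls s n q)
  cls_eq_zero_iff (s : ℕ) (n : ℤ) (q : ℕ) (x : t.Z s n q) : cls s n q x = 0 ↔ x.1 ∈ t.B s n q
  d_cls (s : ℕ) (n : ℤ) (q : ℕ) (x : t.Z s n q) (y : hD (n - 1) (T (q + 1 + s)))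
    (y' : t.Z s (n - 1) (q + 1 + s))
    (hy : t.i (n - 1) (Nat.le_add_right (q + 1) s) y = t.δ n q x.1)
    (hy' : y'.1 = t.j (n - 1) (q + 1 + s) y) :
    (E.page (2 + s)).d (n - q, q) (n - 1 - (q + 1 + s : ℕ), (q + 1 + s : ℕ)) (cls s n q x) =
      cls s (n - 1) (q + 1 + s) y'
  iso_cls (s : ℕ) (n : ℤ) (q : ℕ) (x : t.Z s n q) (x' : t.Z (s + 1) n q) (hx : x.1 = x'.1)
    (c : (E.page (2 + s)).cycles (n - q, q))
    (hc : (E.page (2 + s)).iCycles (n - q, q) c = cls s n q x) :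
    (E.iso (2 + s) (2 + (s + 1 : ℕ)) (n - q, q) (by push_cast; ring) (by lia)).hom
      ((E.page (2 + s)).homologyπ (n - q, q) c) = cls (s + 1) n q x'

/-- Strong convergence of `E` to the graded abelian group `A`: every `A n` has an increasing
filtration `F_p (A n)` which is finite (so it is exhaustive, Hausdorff and complete), in each bidegree
`(n - q, q)` the spectral sequence is stationary from some page `E^{2 + stab}` on, all differentials
into and out of it being zero, and this stable value `E^∞_{n-q,q}` is identified with
`F_{n-q} (A n) / F_{n-q-1} (A n)`. -/
structure StrongConvergence (E : E2SpectralSequence.{u}) (A : ℤ → AddCommGrpCat.{u}) where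
  /-- the subgroup `F_p (A n)` -/
  filt (n p : ℤ) : AddSubgroup (A n)
  mono (n : ℤ) : Monotone (filt n)
  exists_bot (n : ℤ) : ∃ p, filt n p = ⊥
  exists_top (n : ℤ) : ∃ p, filt n p = ⊤
  /-- the spectral sequence is stationary in bidegree `(n - q, q)` from the page `2 + stab n q` on -/
  stab (n q : ℤ) : ℕ
  d_from (n q : ℤ) (s : ℕ) (hs : stab n q ≤ s) (b : ℤ × ℤ) : (E.page (2 + s)).d (n - q, q) b = 0
  d_to (n q : ℤ) (s : ℕ) (hs : stab n q ≤ s) (b : ℤ × ℤ) : (E.page (2 + s)).d b (n - q, q) = 0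
  /-- the isomorphism of the stable value with the graded piece of the filtration -/
  gr (n q : ℤ) : (E.page (2 + stab n q)).X (n - q, q) ≃+
    (filt n (n - q) ⧸ (filt n (n - q - 1)).addSubgroupOf (filt n (n - q)))

/-- Strong convergence of the spectral sequence of a tower `t` to a graded group `A` identified
with the homology of `T 0`: the filtration is given by the images of the `Hₙ(T q)`, and the
identification of `E^∞` with the associated graded group is induced by the maps
`Hₙ(G q) ⟵ Hₙ(T q) ⟶ Hₙ(T 0)`. -/
structure Tower.StrongConvergence {T G : ℕ → DAb.{u}} (t : Tower T G) {E : E2SpectralSequence.{u}}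
    (D : t.SpectralSequenceData E) (A : ℤ → AddCommGrpCat.{u}) (φ : ∀ n, hD n (T 0) ≅ A n) extends
    SemilocalEval.StrongConvergence E A where
  filt_eq (n : ℤ) (q : ℕ) : filt n (n - q) = (t.i n (Nat.zero_le q) ≫ (φ n).hom).hom.range
  gr_cls (n : ℤ) (q : ℕ) (z : hD n (T q)) (x : t.Z (stab n q) n q) (hx : x.1 = t.j n q z)
    (a : filt n (n - q)) (ha : a.1 = (φ n).hom (t.i n (Nat.zero_le q) z)) :
    gr n q (D.cls (stab n q) n q x) = QuotientAddGroup.mk a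

/-! ### The presheaves attached to a complex of presheaves -/

section

variable (F : CochainComplex (Psh k) ℤ)

/-- The presheaf `L = coker (d⁻¹ : F⁻¹ ⟶ F⁰)`. -/
abbrev cokerPsh : Psh k := cokernel (F.d (-1) 0)

/-- The presheaf `K⁻ⁿ = ker (d⁻ⁿ : F⁻ⁿ ⟶ F⁻ⁿ⁺¹)`. -/
abbrev kerPsh (n : ℕ) : Psh k := F.cycles (-n)

/-- The cohomology presheaf `H⁻ⁿ` of the complex `F`. -/
abbrev cohPsh (n : ℕ) : Psh k := F.homology (-n)

/-- The complex `K^{-q-1}(Δ̂•)[-q]` (homological shift). -/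
def towerObj (q : ℕ) : DAb.{u} := (toD.obj ((semilocalEval k).obj (kerPsh F (q + 1))))⟦(q : ℤ)⟧

/-- The complex `H^{-q-1}(Δ̂•)[-q]` (homological shift). -/
def layerObj (q : ℕ) : DAb.{u} := (toD.obj ((semilocalEval k).obj (cohPsh F (q + 1))))⟦(q : ℤ)⟧

/-- The map `K^{-q-1}(Δ̂•)[-q] ⟶ H^{-q-1}(Δ̂•)[-q]` induced by the projection from cocycles to
cohomology. -/
def towerProj (q : ℕ) : towerObj F q ⟶ layerObj F q :=
  (toD.map ((semilocalEval k).map (F.homologyπ (-(q + 1 : ℕ)))))⟦(q : ℤ)⟧'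

/-- An isomorphism `L(Δ̂•) ≅ K⁻¹(Δ̂•)[-2]` in `D(Ab)` identifies the homology of the bottom
`K⁻¹(Δ̂•)` of the tower with the homology of `L(Δ̂•)`, up to a shift of degree by `2`. -/
def abutmentIso
    (e : toD.obj ((semilocalEval k).obj (cokerPsh F)) ≅
      (toD.obj ((semilocalEval k).obj (kerPsh F 1)))⟦(2 : ℤ)⟧) (n : ℤ) :
    hD n (towerObj F 0) ≅ chainHomology ((semilocalEval k).obj (cokerPsh F)) (n + 2) :=
  (DerivedCategory.homologyFunctor _ (-n)).mapIso
      ((shiftFunctorZero' DAb.{u} ((0 : ℕ) : ℤ) (by simp)).app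
        (toD.obj ((semilocalEval k).obj (kerPsh F 1)))) ≪≫
    (((DerivedCategory.homologyFunctor AddCommGrpCat.{u} 0).shiftIso 2 (-(n + 2)) (-n)
      (by ring)).app (toD.obj ((semilocalEval k).obj (kerPsh F 1)))).symm ≪≫
    (DerivedCategory.homologyFunctor _ (-(n + 2))).mapIso e.symm ≪≫
    (DerivedCategory.homologyFunctorFactors _ (-(n + 2))).app
      (toCochain.obj ((semilocalEval k).obj (cokerPsh F)))

end

end SemilocalEval

end

open SemilocalEval

noncomputable section

namespace SemilocalEval

variable {k : Type u} [Field k]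

/-! ### Exactness of the evaluation at semilocal simplices -/

/-! The proof rests on two properties of the evaluation `F ↦ F(Δ̂•)`: it is exact, and it sends a
rationally contractible presheaf to zero in `D(Ab)`.

Exactness holds because `F(Δ̂ⁿ)` is a filtered colimit of values of `F`
(`shortExact_semilocalEval`). Short exact sequences of presheaves therefore become distinguished
triangles (`exists_distinguished`).

For the vanishing, `s : F ⟶ C̃₁F` is first extended to germs, giving a natural map `F(X, S) ⟶ F(X ×
𝔸¹, S × {0, 1})` whose restrictions to the two ends are `0` and the identity (`germHtpy`). Pulling
back along the affine maps `Δⁿ⁺¹ ⟶ Δⁿ × 𝔸¹` of the usual triangulation of the prism gives a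
simplicial homotopy from `0` to `1` on `F(Δ̂•)` (`semilocalContraction`). These maps send vertices
into `vertices × {0, 1}`, which is why germs at that set suffice.

Now let `0 ⟶ K ⟶ X ⟶ Y ⟶ C ⟶ 0` be exact with `X` rationally contractible. Splitting it at the image
of `X ⟶ Y` gives a triangle `K⟦1⟧ ⟶ Y ⟶ C` after evaluation (`exists_distinguished_of_isZero`). For
`K^{-q-2} ⟶ F^{-q-2} ⟶ K^{-q-1} ⟶ H^{-q-1}` this is, after a shift by `q`, one stage of the tower.
For `K⁻¹ ⟶ F⁻¹ ⟶ F⁰ ⟶ L`, where `Y = F⁰` also evaluates to zero, it gives `L ≅ K⁻¹⟦2⟧`.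

The spectral sequence is pure algebra: page `2 + s` of an exact couple is `Z_s / B_s`, and the
kernel and the image of its differential are computed by `dE_cls_eq_zero_iff` and
`mem_range_dE_iff`. Convergence follows because stage `q` of the tower and its layer have homology
only in degrees at least `q`: for fixed `n` only finitely many stages matter, and on late pages both
`E_{n-q,q}` and the graded piece are quotients of `Hₙ(T q)` by the same subgroup. -/

/-- Evaluation of germs at a pair `P`, as the composition of the restriction to the neighbourhoods
of `P` and the colimit functor. -/
def germFunctorEvalIso (P : SmPair k) :
    germFunctor k ⋙ (evaluation _ _).obj (op P) ≅
      (Functor.whiskeringLeft _ _ AddCommGrpCat.{u}).obj P.diag.op ⋙ colim :=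
  NatIso.ofComponents (fun F => Iso.refl _) (fun {F G} η => by
    refine (Category.comp_id _).trans (Eq.trans ?_ (Category.id_comp _).symm)
    refine germ_ext fun U => ?_
    refine (toGerm_germTrans η P U).trans ?_
    symm
    exact ι_colimMap (Functor.whiskerLeft P.diag.op η) (op U))

/-- Finite intersections of neighbourhoods are neighbourhoods, so the opposite poset is filtered.
Colimits over it are then exact in abelian groups, which is what makes taking germs exact. -/
instance (P : SmPair k) : SemilatticeInf P.Nbhd :=
  Subtype.semilatticeInf fun {U V} hU hV x hx =>
    show x ∈ (U : Set P.X.scheme) ∩ V from ⟨hU x hx, hV x hx⟩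

instance (P : SmPair k) : OrderTop P.Nbhd where
  top := ⟨⊤, fun _ _ => trivial⟩
  le_top _ := le_top (α := P.X.scheme.Opens)

instance (P : SmPair k) : PreservesFiniteLimits
    (germFunctor k ⋙ (evaluation _ AddCommGrpCat.{u}).obj (op P)) :=
  preservesFiniteLimits_of_natIso (germFunctorEvalIso P).symm

instance (P : SmPair k) : PreservesFiniteColimits
    (germFunctor k ⋙ (evaluation _ AddCommGrpCat.{u}).obj (op P)) :=
  preservesFiniteColimits_of_natIso (germFunctorEvalIso P).symm

instance : PreservesFiniteLimits (germFunctor k) := by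
  constructor
  intro J _ _
  apply preservesLimitsOfShape_of_evaluation
  intro P
  have : PreservesFiniteLimits (germFunctor k ⋙ (evaluation _ AddCommGrpCat.{u}).obj P) :=
    inferInstanceAs (PreservesFiniteLimits
      (germFunctor k ⋙ (evaluation (SmPair k)ᵒᵖ AddCommGrpCat.{u}).obj (op P.unop)))
  infer_instance

instance : PreservesFiniteColimits (germFunctor k) := by
  constructor
  intro J _ _
  apply preservesColimitsOfShape_of_evaluation
  intro P
  have : PreservesFiniteColimits (germFunctor k ⋙ (evaluation _ AddCommGrpCat.{u}).obj P) :=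
    inferInstanceAs (PreservesFiniteColimits
      (germFunctor k ⋙ (evaluation (SmPair k)ᵒᵖ AddCommGrpCat.{u}).obj (op P.unop)))
  infer_instance

instance : (germFunctor k).Additive := Functor.additive_of_preserves_binary_products _

instance : (AlgebraicTopology.alternatingFaceMapComplex AddCommGrpCat.{u}).Additive where
  map_add {X Y f g} := by ext n : 1; rfl

instance : (semilocalEval k).Additive := by
  unfold semilocalEval; infer_instance

instance : (toCochain.{u}).Additive := by
  unfold toCochain; infer_instance

instance : (toD.{u}).Additive := by
  unfold toD; infer_instance

/-! ### Short exact sequences and contractible complexes in `D(Ab)` -/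

/-- Exactness is tested in each simplicial degree, where the functor takes germs at a single pair.
-/
lemma shortExact_semilocalEval {S : ShortComplex (Psh k)} (hS : S.ShortExact) :
    (S.map (semilocalEval k)).ShortExact :=
  HomologicalComplex.shortExact_of_degreewise_shortExact _ fun n =>
    hS.map_of_exact (germFunctor k ⋙
      (evaluation _ AddCommGrpCat.{u}).obj (op ((semilocalSimplex k).obj (.mk n))))

lemma shortExact_toCochain {S : ShortComplex (ChainComplex AddCommGrpCat.{u} ℕ)}
    (hS : S.ShortExact) : (S.map toCochain).ShortExact := by
  refine HomologicalComplex.shortExact_of_degreewise_shortExact _ fun i => ?_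
  by_cases h : ∃ n, ComplexShape.embeddingDownNat.f n = i
  · obtain ⟨n, hn⟩ := h
    refine ShortComplex.shortExact_of_iso (ShortComplex.isoMk
      (HomologicalComplex.extendXIso _ _ hn).symm
      (HomologicalComplex.extendXIso _ _ hn).symm
      (HomologicalComplex.extendXIso _ _ hn).symm ?_ ?_)
      (hS.map_of_exact (HomologicalComplex.eval _ _ n))
    · exact (Iso.inv_comp_eq _).2 (HomologicalComplex.extendMap_f S.f _ hn)
    · exact (Iso.inv_comp_eq _).2 (HomologicalComplex.extendMap_f S.g _ hn)
  · push Not at h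
    have hz (K : ChainComplex AddCommGrpCat.{u} ℕ) : IsZero ((toCochain.obj K).X i) :=
      HomologicalComplex.isZero_extend_X _ _ _ h
    exact { exact := ShortComplex.exact_of_isZero_X₂ _ (hz S.X₂)
            mono_f := (hz S.X₁).mono _
            epi_g := (hz S.X₃).epi _ }

lemma isZero_toD_of_homotopy {K : ChainComplex AddCommGrpCat.{u} ℕ}
    (h : Homotopy (0 : K ⟶ K) (𝟙 K)) :
    IsZero (toD.obj K) := by
  rw [IsZero.iff_id_eq_zero, ← toD.map_id, ← toD.map_zero]
  exact (DerivedCategory.Q_map_eq_of_homotopy _ (h.extend ComplexShape.embeddingDownNat)).symm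

/-- A short exact sequence of presheaves defines a distinguished triangle in `D(Ab)`. -/
lemma exists_distinguished {S : ShortComplex (Psh k)} (hS : S.ShortExact) :
    ∃ δ : toD.obj ((semilocalEval k).obj S.X₃) ⟶ (toD.obj ((semilocalEval k).obj S.X₁))⟦(1 : ℤ)⟧,
      Pretriangulated.Triangle.mk (toD.map ((semilocalEval k).map S.f))
        (toD.map ((semilocalEval k).map S.g)) δ ∈ Pretriangulated.distinguishedTriangles :=
  ⟨_, DerivedCategory.triangleOfSES_distinguished
    (shortExact_toCochain (shortExact_semilocalEval hS))⟩

/-! ### Germs and open immersions -/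

lemma SmPair.hom_ext {P Q : SmPair k} {f g : P ⟶ Q} (h : f.f = g.f) : f = g := SmPair.Hom.ext h

/-- The image of an open subscheme under an open immersion is isomorphic to it. -/
def Sm.ofImage {X Y : Sm k} (f : X ⟶ Y) [IsOpenImmersion (Sm.mor f)] (U : X.scheme.Opens) :
    Y.opens (Sm.mor f ''ᵁ U) ⟶ X.opens U :=
  Sm.mk (X := Y.opens (Sm.mor f ''ᵁ U)) (Y := X.opens U) ((Sm.mor f).isoImage U).inv (by
    change ((Sm.mor f).isoImage U).inv ≫ U.ι ≫ X.obj.hom = (Sm.mor f ''ᵁ U).ι ≫ Y.obj.hom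
    rw [Iso.inv_comp_eq, Scheme.Hom.isoImage_hom_ι_assoc]
    exact congrArg (U.ι ≫ ·) (Over.w f.hom).symm)

lemma Sm.ofImage_res {X Y : Sm k} (f : X ⟶ Y) [IsOpenImmersion (Sm.mor f)] (U : X.scheme.Opens)
    (V : Y.scheme.Opens) (h : U ≤ Sm.mor f ⁻¹ᵁ V) (h' : Sm.mor f ''ᵁ U ≤ V) :
    Sm.ofImage f U ≫ Sm.res f U V h = Y.incl h' := by
  have key : (((Sm.mor f).isoImage U).inv ≫ (Sm.mor f).resLE V U h) ≫ V.ι =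
      Y.scheme.homOfLE h' ≫ V.ι := by
    rw [Category.assoc, Scheme.Hom.resLE_comp_ι, Scheme.homOfLE_ι, Iso.inv_comp_eq,
      Scheme.Hom.isoImage_hom_ι]
  exact Sm.opens_hom_ext key

lemma Sm.res_ofImage {X Y : Sm k} (f : X ⟶ Y) [IsOpenImmersion (Sm.mor f)] (U : X.scheme.Opens)
    (h : U ≤ Sm.mor f ⁻¹ᵁ Sm.mor f ''ᵁ U) :
    Sm.res f U (Sm.mor f ''ᵁ U) h ≫ Sm.ofImage f U = 𝟙 _ := by
  have key : (Sm.mor f).resLE (Sm.mor f ''ᵁ U) U h ≫ ((Sm.mor f).isoImage U).inv = 𝟙 _ := by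
    rw [Iso.comp_inv_eq, ← cancel_mono (Sm.mor f ''ᵁ U).ι, Scheme.Hom.resLE_comp_ι,
      Category.id_comp, Scheme.Hom.isoImage_hom_ι]
  exact Sm.hom_ext key

lemma Sm.ofImage_incl {X Y : Sm k} (f : X ⟶ Y) [IsOpenImmersion (Sm.mor f)] {U V : X.scheme.Opens}
    (i : U ≤ V) (i' : Sm.mor f ''ᵁ U ≤ Sm.mor f ''ᵁ V) :
    Sm.ofImage f U ≫ X.incl i = Y.incl i' ≫ Sm.ofImage f V := by
  have h : V ≤ Sm.mor f ⁻¹ᵁ Sm.mor f ''ᵁ V := ((Sm.mor f).preimage_image_eq V).ge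
  rw [← Category.comp_id (_ ≫ X.incl i), ← Sm.res_ofImage f V h, Category.assoc,
    ← Category.assoc (X.incl i), Sm.incl_res, ← Category.assoc, Sm.ofImage_res]

/-- If `f : X ⟶ Y` is an open immersion with `T ⊆ f(S)`, then `F(Y, T) ⟶ F(X, S)` is bijective. -/
lemma isIso_germMap (F : Psh k) {P Q : SmPair k} (f : P ⟶ Q) [IsOpenImmersion (Sm.mor f.f)]
    (hf : ∀ y ∈ Q.S, ∃ x ∈ P.S, Sm.mor f.f x = y) : IsIso (germMap F f) := by
  -- By `hf` the open set `f(U)` contains `Q.S`. The inverse map is pullback along the isomorphism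
  -- `f(U) ≅ U`.
  let im (U : P.Nbhd) : Q.Nbhd := ⟨Sm.mor f.f ''ᵁ U.1, fun y hy => by
    obtain ⟨x, hx, rfl⟩ := hf y hy
    exact ⟨x, U.2 x hx, rfl⟩⟩
  have him (U : P.Nbhd) : U.1 ≤ Sm.mor f.f ⁻¹ᵁ (im U).1 :=
    ((Sm.mor f.f).preimage_image_eq U.1).ge
  refine ⟨germDesc (fun U => F.map (Sm.ofImage f.f U.1).op ≫ toGerm F Q (im U)) ?_, ?_, ?_⟩
  · intro U V h
    have h' : (im U).1 ≤ (im V).1 := Set.image_mono h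
    rw [← toGerm_w F Q _ _ h', ← F.map_comp_assoc, ← F.map_comp_assoc, ← op_comp, ← op_comp]
    exact congrArg (fun g => F.map g.op ≫ _) (Sm.ofImage_incl f.f h h')
  · refine germ_ext fun V => ?_
    have h : (im (SmPair.preimage f V)).1 ≤ V.1 := by
      rintro _ ⟨x, hx, rfl⟩; exact hx
    rw [toGerm_germMap_assoc F f _ V (SmPair.preimage_le f V), toGerm_germDesc, Category.comp_id,
      ← toGerm_w F Q _ _ h, ← F.map_comp_assoc, ← op_comp]
    exact congrArg (fun g => F.map g.op ≫ _) (Sm.ofImage_res f.f _ _ _ h)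
  · refine germ_ext fun U => ?_
    rw [toGerm_germDesc_assoc, Category.assoc, toGerm_germMap F f U (im U) (him U),
      ← F.map_comp_assoc, ← op_comp, Category.comp_id]
    refine Eq.trans ?_ (Category.id_comp _)
    rw [← F.map_id]
    exact congrArg (fun g => F.map g.op ≫ _) (Sm.res_ofImage f.f _ _)

/-! ### The homotopy on germs of a rationally contractible presheaf -/

/-- The inclusion of an open subscheme. -/
def Sm.ι (X : Sm k) (U : X.scheme.Opens) : X.opens U ⟶ X := Sm.mk (X := X.opens U) U.ι rfl

lemma Sm.res_ι {X Y : Sm k} (f : X ⟶ Y) (U : X.scheme.Opens) (V : Y.scheme.Opens)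
    (h : U ≤ (Sm.mor f) ⁻¹ᵁ V) : Sm.res f U V h ≫ Y.ι V = X.ι U ≫ f :=
  Sm.hom_ext ((Sm.mor f).resLE_comp_ι h)

lemma Sm.lift_ι {X Y : Sm k} (f : X ⟶ Y) (V : Y.scheme.Opens) (h : ∀ x, Sm.mor f x ∈ V) :
    Sm.lift f V h ≫ Y.ι V = f :=
  Sm.hom_ext (liftOpens_ι _ _ h)

instance Sm.mono_ι (X : Sm k) (U : X.scheme.Opens) : Mono (X.ι U) where
  right_cancellation _ _ h := Sm.opens_hom_ext (congrArg Sm.mor h)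

instance Sm.isOpenImmersion_ι (X : Sm k) (U : X.scheme.Opens) : IsOpenImmersion (Sm.mor (X.ι U)) :=
  inferInstanceAs (IsOpenImmersion U.ι)

instance Sm.isOpenImmersion_A1map {X Y : Sm k} (f : X ⟶ Y) [IsOpenImmersion (Sm.mor f)] :
    IsOpenImmersion (Sm.mor (Sm.A1map f)) :=
  MorphismProperty.of_isPullback (P := @IsOpenImmersion)
    (AffineSpace.isPullback_map (n := PUnit.{u + 1}) (Sm.mor f)).flip inferInstance

namespace SmPair

/-- The pair `(U, S ∩ U)` for an open neighbourhood `U` of `S`. -/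
abbrev restr (P : SmPair k) (U : P.Nbhd) : SmPair k := ⟨P.X.opens U.1, Sm.mor (P.X.ι U.1) ⁻¹' P.S⟩

/-- The inclusion `(U, S ∩ U) ⟶ (X, S)`. -/
abbrev restrι (P : SmPair k) (U : P.Nbhd) : P.restr U ⟶ P := ⟨P.X.ι U.1, fun _ hx => hx⟩

/-- The restriction of a morphism of pairs to neighbourhoods. -/
def restrMap {P Q : SmPair k} (f : P ⟶ Q) (U : P.Nbhd) (V : Q.Nbhd)
    (h : U.1 ≤ Sm.mor f.f ⁻¹ᵁ V.1) : P.restr U ⟶ Q.restr V :=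
  ⟨Sm.res f.f U.1 V.1 h, fun x hx => by
    have : Sm.mor (Q.X.ι V.1) (Sm.mor (Sm.res f.f U.1 V.1 h) x) =
        Sm.mor f.f (Sm.mor (P.X.ι U.1) x) := congrArg (fun g => Sm.mor g x) (Sm.res_ι f.f U.1 V.1 h)
    have h' := f.mapsTo _ hx
    rw [← this] at h'
    exact h'⟩

lemma restrMap_restrι {P Q : SmPair k} (f : P ⟶ Q) (U : P.Nbhd) (V : Q.Nbhd)
    (h : U.1 ≤ Sm.mor f.f ⁻¹ᵁ V.1) : restrMap f U V h ≫ Q.restrι V = P.restrι U ≫ f :=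
  hom_ext (Sm.res_ι _ _ _ h)

lemma restrι_surj (P : SmPair k) (U : P.Nbhd) (y : P.X.scheme) (hy : y ∈ P.S) :
    ∃ x ∈ (P.restr U).S, Sm.mor (P.restrι U).f x = y :=
  ⟨⟨y, U.2 y hy⟩, hy, rfl⟩

/-- The cylinder `(X × 𝔸¹, S × {0, 1})`. -/
def cyl (P : SmPair k) : SmPair k :=
  ⟨P.X.A1, { y | ∃ c : Fin 2, ∃ x ∈ P.S, Sm.mor (P.X.sec c.val) x = y }⟩

lemma sec_A1map_apply {X Y : Sm k} (f : X ⟶ Y) (c : ℕ) (x : X.scheme) :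
    Sm.mor (Sm.A1map f) (Sm.mor (X.sec c) x) = Sm.mor (Y.sec c) (Sm.mor f x) := by
  have := congrArg (fun g => Sm.mor g x) (Sm.sec_A1map f c)
  simpa [Sm.mor_comp] using this

/-- The functoriality of the cylinder. -/
def cylMap {P Q : SmPair k} (f : P ⟶ Q) : P.cyl ⟶ Q.cyl :=
  ⟨Sm.A1map f.f, by
    rintro _ ⟨c, x, hx, rfl⟩
    exact ⟨c, _, f.mapsTo x hx, (sec_A1map_apply f.f c x).symm⟩⟩

lemma cylMap_comp {P Q R : SmPair k} (f : P ⟶ Q) (g : Q ⟶ R) :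
    cylMap (f ≫ g) = cylMap f ≫ cylMap g :=
  hom_ext (Sm.hom_ext (AffineSpace.map_comp _ _))

/-- The section `x ↦ (x, c)` of the cylinder, for `c = 0, 1`. -/
def cylSec (P : SmPair k) (c : Fin 2) : P ⟶ P.cyl := ⟨P.X.sec c.val, fun x hx => ⟨c, x, hx, rfl⟩⟩

lemma cylSec_cylMap {P Q : SmPair k} (f : P ⟶ Q) (c : Fin 2) :
    P.cylSec c ≫ cylMap f = f ≫ Q.cylSec c :=
  hom_ext (Sm.sec_A1map f.f c.val)

/-- The comparison `(X × 𝔸¹, S × {0, 1}) ⟶ (X × 𝔸¹, X × {0, 1})`. -/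
def toCyl (P : SmPair k) : P.cyl ⟶ (SemilocalEval.cyl k).obj P.X :=
  ⟨𝟙 _, by
    rintro _ ⟨c, x, -, rfl⟩
    exact cylSec_mem P.X c x⟩

lemma cylMap_toCyl {P Q : SmPair k} (f : P ⟶ Q) :
    cylMap f ≫ Q.toCyl = P.toCyl ≫ (SemilocalEval.cyl k).map f.f :=
  hom_ext ((Category.comp_id _).trans (Category.id_comp _).symm)

end SmPair

instance (F : Psh k) (P : SmPair k) (U : P.Nbhd) : IsIso (germMap F (P.restrι U)) :=
  have : IsOpenImmersion (Sm.mor (P.restrι U).f) := Sm.isOpenImmersion_ι _ _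
  isIso_germMap F _ (P.restrι_surj U)

/-- Germs at `S × {0, 1}` do not change when `X × 𝔸¹` is replaced by `U × 𝔸¹`. Hence `s`, applied to
sections over `U` only, still produces germs on the cylinder of `(X, S)`. -/
instance (F : Psh k) (P : SmPair k) (U : P.Nbhd) :
    IsIso (germMap F (SmPair.cylMap (P.restrι U))) :=
  have : IsOpenImmersion (Sm.mor (P.restrι U).f) := Sm.isOpenImmersion_ι _ _
  have : IsOpenImmersion (Sm.mor (SmPair.cylMap (P.restrι U)).f) := Sm.isOpenImmersion_A1map _
  isIso_germMap F _ (by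
    rintro _ ⟨c, y, hy, rfl⟩
    obtain ⟨x, hx, rfl⟩ := P.restrι_surj U y hy
    exact ⟨_, ⟨c, x, hx, rfl⟩, SmPair.sec_A1map_apply _ _ _⟩)

/-- The canonical map `F(X) ⟶ F(X, S)`. -/
def ofGlobal (F : Psh k) (P : SmPair k) : F.obj (op P.X) ⟶ germ F P :=
  F.map (P.X.ι ⊤).op ≫ toGerm F P ⊤

lemma toGerm_germMap_restrι (F : Psh k) (P : SmPair k) (U : P.Nbhd) :
    toGerm F P U ≫ germMap F (P.restrι U) = ofGlobal F (P.restr U) := by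
  have h : (⊤ : (P.restr U).X.scheme.Opens) ≤ Sm.mor (P.restrι U).f ⁻¹ᵁ U.1 := fun x _ => x.2
  have h' : Sm.res (P.X.ι U.1) ⊤ U.1 h = (P.X.opens U.1).ι ⊤ := by
    rw [← cancel_mono (P.X.ι U.1), Sm.res_ι]
  rw [toGerm_germMap F _ ⊤ U h, ofGlobal, ← h']
  rfl

lemma germMap_cylSec_toCyl (F : Psh k) (P : SmPair k) (c : Fin 2) :
    germMap F (P.cylSec c ≫ P.toCyl) = iStarApp F c P.X ≫ ofGlobal F P := by
  refine germ_ext fun V => ?_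
  have h0 : (P.cylSec c ≫ P.toCyl).f = cylSec P.X c := Category.comp_id _
  -- A neighbourhood `V` of `X × {0, 1}` contains the whole section `X × {c}`, so its preimage is
  -- all of `X` and not merely a neighbourhood of `S`.
  have h : (⊤ : P.X.scheme.Opens) ≤ Sm.mor (P.cylSec c ≫ P.toCyl).f ⁻¹ᵁ V.1 :=
    fun x _ => by rw [h0]; exact V.2 _ (cylSec_mem _ c x)
  rw [toGerm_germMap F _ ⊤ V h, iStarApp, toGerm_germDesc_assoc, ofGlobal, ← F.map_comp_assoc,
    ← op_comp]
  congr 3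
  rw [← cancel_mono (((SemilocalEval.cyl k).obj P.X).X.ι V.1), Sm.res_ι, Category.assoc, Sm.lift_ι]
  exact congrArg _ h0

section

variable {F : Psh k} (s : F ⟶ C1 F)

/-- The map `F(X) ⟶ F(X × 𝔸¹, X × {0, 1})` given by `s : F ⟶ C̃₁F`. -/
def htpyApp (X : Sm k) : F.obj (op X) ⟶ germ F ((cyl k).obj X) := s.app (op X)

lemma htpyApp_naturality {X Y : Sm k} (f : X ⟶ Y) :
    htpyApp s Y ≫ germMap F ((cyl k).map f) = F.map f.op ≫ htpyApp s X :=
  (s.naturality f.op).symm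

lemma htpyApp_iStarApp (X : Sm k) (c : Fin 2) :
    htpyApp s X ≫ iStarApp F c X = (s ≫ iStar F c).app (op X) := rfl

/-- The map `F(X) ⟶ F(X × 𝔸¹, S × {0, 1})` defined by `s : F ⟶ C̃₁F`. -/
def globalHtpy (P : SmPair k) : F.obj (op P.X) ⟶ germ F P.cyl :=
  htpyApp s P.X ≫ germMap F P.toCyl

lemma globalHtpy_naturality {P Q : SmPair k} (f : P ⟶ Q) :
    globalHtpy s Q ≫ germMap F (SmPair.cylMap f) = F.map f.f.op ≫ globalHtpy s P := by
  rw [globalHtpy, globalHtpy, Category.assoc, ← germMap_comp, SmPair.cylMap_toCyl, germMap_comp,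
    ← Category.assoc, htpyApp_naturality, Category.assoc]

/-- The map `F(X, S) ⟶ F(X × 𝔸¹, S × {0, 1})` defined by `s : F ⟶ C̃₁F`. -/
def germHtpy (P : SmPair k) : germ F P ⟶ germ F P.cyl :=
  -- On `F(U)`: apply `s` over `U`, then use that `U × 𝔸¹` and `X × 𝔸¹` have the same germs at `S ×
  -- {0, 1}`.
  germDesc (fun U => globalHtpy s (P.restr U) ≫ inv (germMap F (SmPair.cylMap (P.restrι U))))
    (fun U V h => by
      let i : P.restr U ⟶ P.restr V := SmPair.restrMap (𝟙 P) U V h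
      have hi : i ≫ P.restrι V = P.restrι U :=
        (SmPair.restrMap_restrι (𝟙 P) U V h).trans (Category.comp_id _)
      have hi' : i.f = P.X.incl h := (Sm.incl_eq h).symm
      rw [← hi', ← Category.assoc, ← globalHtpy_naturality, IsIso.comp_inv_eq, ← hi,
        SmPair.cylMap_comp, germMap_comp, Category.assoc, IsIso.inv_hom_id_assoc])

lemma toGerm_germHtpy (P : SmPair k) (U : P.Nbhd) :
    toGerm F P U ≫ germHtpy s P ≫ germMap F (SmPair.cylMap (P.restrι U)) =
      globalHtpy s (P.restr U) := by
  rw [germHtpy, toGerm_germDesc_assoc, Category.assoc, IsIso.inv_hom_id, Category.comp_id]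

lemma germHtpy_naturality {P Q : SmPair k} (f : P ⟶ Q) :
    germHtpy s Q ≫ germMap F (SmPair.cylMap f) = germMap F f ≫ germHtpy s P := by
  refine germ_ext fun V => ?_
  have hU := SmPair.preimage_le f V
  -- The map `germHtpy` is known explicitly only after restriction to the cylinder over a
  -- neighbourhood, which is an isomorphism on germs and may be cancelled.
  rw [← cancel_mono (germMap F (SmPair.cylMap (P.restrι (SmPair.preimage f V)))),
    toGerm_germMap_assoc F f _ V hU]
  simp only [Category.assoc]
  rw [toGerm_germHtpy, ← germMap_comp, ← SmPair.cylMap_comp, ← SmPair.restrMap_restrι f _ V hU,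
    SmPair.cylMap_comp, germMap_comp, ← Category.assoc (germHtpy s Q), ← Category.assoc,
    toGerm_germHtpy, globalHtpy_naturality]
  rfl

/-- This carries the conditions `i_0^* s = 0` and `i_1^* s = 1` over to germs; it computes the two
ends of the homotopy. -/
lemma germHtpy_germMap_cylSec (P : SmPair k) (c : Fin 2) :
    germHtpy s P ≫ germMap F (P.cylSec c) = germTrans (s ≫ iStar F c) P := by
  refine germ_ext fun U => ?_
  rw [toGerm_germTrans, ← cancel_mono (germMap F (P.restrι U)), Category.assoc, Category.assoc,
    Category.assoc, ← germMap_comp, ← SmPair.cylSec_cylMap, germMap_comp,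
    ← Category.assoc (germHtpy s P), ← Category.assoc, toGerm_germHtpy, toGerm_germMap_restrι,
    globalHtpy, Category.assoc, ← germMap_comp, germMap_cylSec_toCyl, ← Category.assoc,
    htpyApp_iStarApp]

end

/-! ### Prisms -/

/-- The linear function with prescribed values `χ` at the vertices is the `𝔸¹`-coordinate of a prism
map. Its naturality amounts to grouping the sum by the fibres of `θ`. -/
lemma SimplexRing.map_sum_t {m n : ℕ} (θ : Fin (m + 1) → Fin (n + 1)) (χ : Fin (n + 1) → Fin 2) :
    SimplexRing.map (k := k) θ (∑ j, ((χ j : ℕ) : SimplexRing k n) * SimplexRing.t j) =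
      ∑ i, ((χ (θ i) : ℕ) : SimplexRing k m) * SimplexRing.t i := by
  rw [map_sum]
  refine Eq.trans ?_ (Finset.sum_fiberwise Finset.univ θ _)
  refine Finset.sum_congr rfl fun j _ => ?_
  rw [map_mul, map_natCast, SimplexRing.map_t, Finset.mul_sum]
  refine Finset.sum_congr rfl fun i hi => ?_
  rw [(Finset.mem_filter.1 hi).2]

/-- The function `∑ χᵢ tᵢ` on the simplex. -/
def vertexFn {m : ℕ} (χ : Fin (m + 1) → Fin 2) : Γ((simplex k m).scheme, ⊤) :=
  (Scheme.ΓSpecIso (CommRingCat.of (SimplexRing k m))).inv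
    (∑ i, ((χ i : ℕ) : SimplexRing k m) * SimplexRing.t i)

lemma appTop_vertexFn {m n : ℕ} (θ : Fin (m + 1) → Fin (n + 1)) (χ : Fin (n + 1) → Fin 2) :
    (Sm.mor (simplexMk (k := k) (SimplexRing.map θ))).appTop (vertexFn χ) = vertexFn (χ ∘ θ) := by
  have h := congrArg (fun g => g (∑ i, ((χ i : ℕ) : SimplexRing k n) * SimplexRing.t i))
    (Scheme.ΓSpecIso_inv_naturality
      (CommRingCat.ofHom (SimplexRing.map (k := k) θ).toRingHom))
  refine (Eq.trans h.symm ?_)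
  exact congrArg (Scheme.ΓSpecIso (CommRingCat.of (SimplexRing k m))).inv
    (SimplexRing.map_sum_t θ χ)

lemma vertexFn_const {m : ℕ} (c : Fin 2) :
    vertexFn (k := k) (m := m) (fun _ => c) = (c : ℕ) := by
  rw [vertexFn, ← Finset.mul_sum, SimplexRing.sum_t, mul_one, map_natCast]
  rfl

/-- The linear map of simplices given by a map of vertices. -/
abbrev simplexMap {m n : ℕ} (θ : Fin (m + 1) → Fin (n + 1)) : simplex k m ⟶ simplex k n :=
  simplexMk (SimplexRing.map θ)

lemma simplexMap_comp {l m n : ℕ} (θ : Fin (l + 1) → Fin (m + 1)) (η : Fin (m + 1) → Fin (n + 1)) :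
    simplexMap (k := k) θ ≫ simplexMap η = simplexMap (η ∘ θ) := by
  refine Sm.hom_ext ?_
  change Spec.map _ ≫ Spec.map _ = Spec.map _
  rw [← Spec.map_comp, ← CommRingCat.ofHom_comp, ← SimplexRing.map_comp]
  rfl

lemma simplexMap_id (n : ℕ) : simplexMap (k := k) (id : Fin (n + 1) → _) = 𝟙 _ := by
  refine Sm.hom_ext ?_
  change Spec.map (CommRingCat.ofHom (SimplexRing.map (k := k) id).toRingHom) = 𝟙 _
  rw [SimplexRing.map_id]
  exact Spec.map_id _

/-- The affine map `Δᵐ ⟶ Δⁿ × 𝔸¹` with `vᵢ ↦ (v_{θ(i)}, χ(i))`. -/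
def prism {m n : ℕ} (θ : Fin (m + 1) → Fin (n + 1)) (χ : Fin (m + 1) → Fin 2) :
    simplex k m ⟶ (simplex k n).A1 :=
  Sm.mk (Y := (simplex k n).A1)
    (AffineSpace.homOfVector (Sm.mor (simplexMap θ)) fun _ => vertexFn χ) (by
    change _ ≫ 𝔸(PUnit.{u + 1}; _) ↘ _ ≫ _ = _
    rw [AffineSpace.homOfVector_over_assoc]
    exact Over.w (simplexMap θ).hom)

/-- Affine maps compose as their maps of vertices do. With `prism_A1map`, this reduces the
simplicial identities of the homotopy to identities between maps of finite sets. -/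
lemma simplexMap_prism {l m n : ℕ} (ψ : Fin (l + 1) → Fin (m + 1)) (θ : Fin (m + 1) → Fin (n + 1))
    (χ : Fin (m + 1) → Fin 2) :
    simplexMap ψ ≫ prism (k := k) θ χ = prism (θ ∘ ψ) (χ ∘ ψ) := by
  refine Sm.hom_ext ?_
  change Sm.mor (simplexMap ψ) ≫
      AffineSpace.homOfVector (Sm.mor (simplexMap θ)) (fun _ => vertexFn χ)
    = AffineSpace.homOfVector (Sm.mor (simplexMap (θ ∘ ψ))) (fun _ => vertexFn (χ ∘ ψ))
  rw [AffineSpace.comp_homOfVector, ← Sm.mor_comp, simplexMap_comp]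
  congr 1
  funext
  exact appTop_vertexFn ψ χ

lemma prism_A1map {l m n : ℕ} (θ : Fin (l + 1) → Fin (m + 1)) (χ : Fin (l + 1) → Fin 2)
    (η : Fin (m + 1) → Fin (n + 1)) :
    prism (k := k) θ χ ≫ Sm.A1map (simplexMap η) = prism (η ∘ θ) χ := by
  refine Sm.hom_ext ?_
  change AffineSpace.homOfVector (Sm.mor (simplexMap θ)) (fun _ => vertexFn χ) ≫
    AffineSpace.map PUnit.{u + 1} (Sm.mor (simplexMap η))
    = AffineSpace.homOfVector (Sm.mor (simplexMap (η ∘ θ))) (fun _ => vertexFn χ)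
  apply AffineSpace.hom_ext
  · rw [Category.assoc, AffineSpace.map_over, AffineSpace.homOfVector_over_assoc,
      AffineSpace.homOfVector_over, ← Sm.mor_comp, simplexMap_comp]
  · intro i
    rw [Scheme.Hom.comp_appTop, CommRingCat.comp_apply, AffineSpace.map_appTop_coord,
      AffineSpace.homOfVector_appTop_coord, AffineSpace.homOfVector_appTop_coord]

lemma prism_const (n : ℕ) (c : Fin 2) :
    prism (k := k) (id : Fin (n + 1) → _) (fun _ => c) = (simplex k n).sec c := by
  refine Sm.hom_ext ?_
  change AffineSpace.homOfVector (Sm.mor (simplexMap (id : Fin (n + 1) → _))) (fun _ => vertexFn _)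
    = AffineSpace.homOfVector (𝟙 _) _
  rw [simplexMap_id, vertexFn_const]
  rfl

lemma prism_vertex {m n : ℕ} (θ : Fin (m + 1) → Fin (n + 1)) (χ : Fin (m + 1) → Fin 2)
    (i : Fin (m + 1)) :
    Sm.mor (prism (k := k) θ χ) (vertex i) =
      Sm.mor ((simplex k n).sec (χ i)) (vertex (θ i)) := by
  -- The vertex `vᵢ` is the image of `Δ⁰`, and on `Δ⁰` every `χ` is constant, so the prism map
  -- becomes a section of the cylinder.
  have h1 : simplexMap (k := k) (fun _ : Fin 1 => i) ≫ prism θ χ =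
      simplexMap (fun _ => θ i) ≫ (simplex k n).sec (χ i) := by
    rw [simplexMap_prism, ← Sm.sec_A1map, ← prism_const, prism_A1map]
    rfl
  have h2 := congrArg (fun g => Sm.mor g (vertex 0)) h1
  have h3 := simplexMk_vertex (k := k) (fun _ : Fin 1 => i) 0
  have h4 := simplexMk_vertex (k := k) (fun _ : Fin 1 => θ i) 0
  rw [← h3, ← h4]
  exact h2

variable (k) in
/-- The pair of a simplex and its vertices. -/
abbrev simplexPair (n : ℕ) : SmPair k := ⟨simplex k n, Set.range vertex⟩

/-- The morphism of pairs `(Δᵐ, vertices) ⟶ (Δⁿ × 𝔸¹, vertices × {0, 1})`. -/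
abbrev prismPair {m n : ℕ} (θ : Fin (m + 1) → Fin (n + 1)) (χ : Fin (m + 1) → Fin 2) :
    simplexPair k m ⟶ (simplexPair k n).cyl :=
  ⟨prism θ χ, by
    rintro _ ⟨i, rfl⟩
    exact ⟨χ i, _, ⟨θ i, rfl⟩, (prism_vertex θ χ i).symm⟩⟩

/-- The morphism of pairs given by a map of vertices. -/
abbrev simplexPairMap {m n : ℕ} (θ : Fin (m + 1) → Fin (n + 1)) :
    simplexPair k m ⟶ simplexPair k n :=
  ⟨simplexMap θ, by
    rintro _ ⟨i, rfl⟩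
    exact ⟨_, (simplexMk_vertex _ i).symm⟩⟩

section

variable {F : Psh k} (s : F ⟶ C1 F)

/-- The map `F(Δ̂ⁿ) ⟶ F(Δ̂ᵐ)` given by a map `(θ, χ)` from the vertices of `Δᵐ` to those of
`Δⁿ × Δ¹`. -/
def prismHtpy {m n : ℕ} (θ : Fin (m + 1) → Fin (n + 1)) (χ : Fin (m + 1) → Fin 2) :
    germ F (simplexPair k n) ⟶ germ F (simplexPair k m) :=
  germHtpy s _ ≫ germMap F (prismPair θ χ)

lemma prismHtpy_germMap {l m n : ℕ} (ψ : Fin (l + 1) → Fin (m + 1)) (θ : Fin (m + 1) → Fin (n + 1))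
    (χ : Fin (m + 1) → Fin 2) :
    prismHtpy s θ χ ≫ germMap F (simplexPairMap ψ) = prismHtpy s (θ ∘ ψ) (χ ∘ ψ) := by
  rw [prismHtpy, prismHtpy, Category.assoc, ← germMap_comp]
  congr 2
  exact SmPair.hom_ext (simplexMap_prism _ _ _)

lemma germMap_prismHtpy {l m n : ℕ} (θ : Fin (l + 1) → Fin (m + 1)) (χ : Fin (l + 1) → Fin 2)
    (η : Fin (m + 1) → Fin (n + 1)) :
    germMap F (simplexPairMap η) ≫ prismHtpy s θ χ = prismHtpy s (η ∘ θ) χ := by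
  rw [prismHtpy, prismHtpy, ← Category.assoc, ← germHtpy_naturality, Category.assoc, ← germMap_comp]
  congr 2
  exact SmPair.hom_ext (prism_A1map _ _ _)

lemma prismHtpy_const (n : ℕ) (c : Fin 2) :
    prismHtpy s (id : Fin (n + 1) → _) (fun _ => c) = germTrans (s ≫ iStar F c) _ := by
  rw [← germHtpy_germMap_cylSec, prismHtpy]
  congr 2
  exact SmPair.hom_ext (prism_const _ _)

end

/-! ### The simplicial contraction of `F(Δ̂•)` -/

variable (k) in
/-- The simplicial abelian group `n ↦ F(Δ̂ⁿ)`. -/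
abbrev semilocalSimplicial (F : Psh k) : SimplicialObject AddCommGrpCat.{u} :=
  (semilocalSimplex k).op ⋙ (germFunctor k).obj F

lemma prismHtpy_congr {F : Psh k} (s : F ⟶ C1 F) {m n : ℕ} {θ θ' : Fin (m + 1) → Fin (n + 1)}
    {χ χ' : Fin (m + 1) → Fin 2} (h : ∀ i, θ i = θ' i) (h' : ∀ i, χ i = χ' i) :
    prismHtpy s θ χ = prismHtpy s θ' χ' := by
  rw [funext h, funext h']

section

variable {F : Psh k} (s : F ⟶ C1 F) {m n : ℕ}

lemma prismHtpy_δ (θ : Fin (m + 2) → Fin (n + 1)) (χ : Fin (m + 2) → Fin 2) (i : Fin (m + 2)) :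
    prismHtpy s θ χ ≫ (semilocalSimplicial k F).δ i =
      prismHtpy s (fun l => θ (i.succAbove l)) (fun l => χ (i.succAbove l)) :=
  prismHtpy_germMap s i.succAbove θ χ

lemma prismHtpy_σ (θ : Fin (m + 1) → Fin (n + 1)) (χ : Fin (m + 1) → Fin 2) (i : Fin (m + 1)) :
    prismHtpy s θ χ ≫ (semilocalSimplicial k F).σ i =
      prismHtpy s (fun l => θ (i.predAbove l)) (fun l => χ (i.predAbove l)) :=
  prismHtpy_germMap s i.predAbove θ χ

lemma δ_prismHtpy (θ : Fin (m + 1) → Fin (n + 1)) (χ : Fin (m + 1) → Fin 2) (i : Fin (n + 2)) :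
    (semilocalSimplicial k F).δ i ≫ prismHtpy s θ χ = prismHtpy s (fun l => i.succAbove (θ l)) χ :=
  germMap_prismHtpy s θ χ i.succAbove

lemma σ_prismHtpy (θ : Fin (m + 1) → Fin (n + 2)) (χ : Fin (m + 1) → Fin 2) (i : Fin (n + 1)) :
    (semilocalSimplicial k F).σ i ≫ prismHtpy s θ χ = prismHtpy s (fun l => i.predAbove (θ l)) χ :=
  germMap_prismHtpy s θ χ i.predAbove

end

/-- Once faces and degeneracies are case distinctions on values, the simplicial identities below are
linear arithmetic. -/
lemma val_succAbove_eq_ite {n : ℕ} (i : Fin (n + 1)) (l : Fin n) :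
    (i.succAbove l : ℕ) = if (l : ℕ) < i then (l : ℕ) else l + 1 := by
  simp only [Fin.succAbove, Fin.lt_def, Fin.val_castSucc]
  split_ifs <;> simp

lemma val_predAbove_eq_ite {n : ℕ} (i : Fin n) (l : Fin (n + 1)) :
    (i.predAbove l : ℕ) = if (i : ℕ) < l then (l : ℕ) - 1 else l := by
  simp only [Fin.predAbove, Fin.lt_def, Fin.val_castSucc]
  split_ifs <;> simp

set_option linter.unusedSimpArgs false in
/-- The prism operators contract the simplicial abelian group `F(Δ̂•)` of a rationally contractible
presheaf. -/
def semilocalContraction {F : Psh k} (s : F ⟶ C1 F) (h0 : s ≫ iStar F 0 = 0)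
    (h1 : s ≫ iStar F 1 = 𝟙 F) :
    SimplicialObject.Homotopy (0 : semilocalSimplicial k F ⟶ semilocalSimplicial k F) (𝟙 _) where
  -- The `i`-th top simplex of `Δⁿ × Δ¹`, with vertices `(v₀, 0), …, (vᵢ, 0), (vᵢ, 1), …, (vₙ, 1)`.
  -- Omitting the first vertex for `i = 0` leaves the end `1`; omitting the last for `i = n` leaves
  -- the end `0`.
  h {n} i := prismHtpy s i.predAbove fun j => if i.castSucc < j then 1 else 0
  h_zero_comp_δ_zero n := by
    have : prismHtpy s (id : Fin (n + 1) → _) (fun _ => 1) = 𝟙 _ := by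
      rw [prismHtpy_const, h1]
      exact congrArg (fun f => f.app (op (simplexPair k n))) ((germFunctor k).map_id F)
    exact (prismHtpy_δ s _ _ _).trans (Eq.trans (prismHtpy_congr s (by simp) (by simp)) this)
  h_last_comp_δ_last n := by
    have : prismHtpy s (id : Fin (n + 1) → _) (fun _ => 0) = 0 := by
      rw [prismHtpy_const, h0]
      exact congrArg (fun f => f.app (op (simplexPair k n))) ((germFunctor k).map_zero F F)
    exact (prismHtpy_δ s _ _ _).trans (Eq.trans (prismHtpy_congr s (by simp)
      (by simp [Fin.le_last])) this)
  -- Here and in the remaining fields both sides are prism operators; the two goals compare their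
  -- vertex maps `θ` and their heights `χ`.
  h_succ_comp_δ_castSucc_of_lt {n} i j hij := by
    refine (prismHtpy_δ s _ _ _).trans (Eq.trans (prismHtpy_congr s ?_ ?_)
      (δ_prismHtpy s _ _ _).symm)
    · intro l
      simp only [Fin.ext_iff, Fin.le_def, Fin.lt_def, val_succAbove_eq_ite, val_predAbove_eq_ite,
        Fin.val_succ, Fin.val_castSucc] at *
      split_ifs <;> omega
    · intro l
      refine if_congr ?_ rfl rfl
      simp only [Fin.le_def, Fin.lt_def, val_succAbove_eq_ite, val_predAbove_eq_ite, Fin.val_succ,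
        Fin.val_castSucc] at *
      split_ifs <;> omega
  h_succ_comp_δ_castSucc_succ {n} j := by
    refine (prismHtpy_δ s _ _ _).trans (Eq.trans (prismHtpy_congr s ?_ ?_)
      (prismHtpy_δ s _ _ _).symm)
    · intro l
      simp only [Fin.ext_iff, Fin.le_def, Fin.lt_def, val_succAbove_eq_ite, val_predAbove_eq_ite,
        Fin.val_succ, Fin.val_castSucc] at *
      split_ifs <;> omega
    · intro l
      refine if_congr ?_ rfl rfl
      simp only [Fin.le_def, Fin.lt_def, val_succAbove_eq_ite, val_predAbove_eq_ite, Fin.val_succ,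
        Fin.val_castSucc] at *
      split_ifs <;> omega
  h_castSucc_comp_δ_succ_of_lt {n} i j hji := by
    refine (prismHtpy_δ s _ _ _).trans (Eq.trans (prismHtpy_congr s ?_ ?_)
      (δ_prismHtpy s _ _ _).symm)
    · intro l
      simp only [Fin.ext_iff, Fin.le_def, Fin.lt_def, val_succAbove_eq_ite, val_predAbove_eq_ite,
        Fin.val_succ, Fin.val_castSucc] at *
      split_ifs <;> omega
    · intro l
      refine if_congr ?_ rfl rfl
      simp only [Fin.le_def, Fin.lt_def, val_succAbove_eq_ite, val_predAbove_eq_ite, Fin.val_succ,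
        Fin.val_castSucc] at *
      split_ifs <;> omega
  h_comp_σ_castSucc_of_le {n} i j hij := by
    refine (prismHtpy_σ s _ _ _).trans (Eq.trans (prismHtpy_congr s ?_ ?_)
      (σ_prismHtpy s _ _ _).symm)
    · intro l
      simp only [Fin.ext_iff, Fin.le_def, Fin.lt_def, val_succAbove_eq_ite, val_predAbove_eq_ite,
        Fin.val_succ, Fin.val_castSucc] at *
      split_ifs <;> omega
    · intro l
      refine if_congr ?_ rfl rfl
      simp only [Fin.le_def, Fin.lt_def, val_succAbove_eq_ite, val_predAbove_eq_ite, Fin.val_succ,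
        Fin.val_castSucc] at *
      split_ifs <;> omega
  h_comp_σ_succ_of_lt {n} i j hji := by
    refine (prismHtpy_σ s _ _ _).trans (Eq.trans (prismHtpy_congr s ?_ ?_)
      (σ_prismHtpy s _ _ _).symm)
    · intro l
      simp only [Fin.ext_iff, Fin.le_def, Fin.lt_def, val_succAbove_eq_ite, val_predAbove_eq_ite,
        Fin.val_succ, Fin.val_castSucc] at *
      split_ifs <;> omega
    · intro l
      refine if_congr ?_ rfl rfl
      simp only [Fin.le_def, Fin.lt_def, val_succAbove_eq_ite, val_predAbove_eq_ite, Fin.val_succ,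
        Fin.val_castSucc] at *
      split_ifs <;> omega

/-- The complex `F(Δ̂•)` of a rationally contractible presheaf is zero in `D(Ab)`. -/
lemma RationallyContractible.isZero_toD {F : Psh k} (hF : RationallyContractible F) :
    IsZero (toD.obj ((semilocalEval k).obj F)) := by
  obtain ⟨s, h0, h1⟩ := hF
  have H := (semilocalContraction s h0 h1).toChainHomotopy
  rw [Functor.map_zero, CategoryTheory.Functor.map_id] at H
  exact isZero_toD_of_homotopy H

/-! ### Homology of complexes of abelian groups -/

section

variable {ι : Type*} {c : ComplexShape ι} (K : HomologicalComplex AddCommGrpCat.{u} c) (j : ι)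

lemma homologyπ_eq_zero_of_d_eq {i : ι} (w : K.X i) (z : K.cycles j)
    (h : K.d i j w = K.iCycles j z) : K.homologyπ j z = 0 := by
  have hz : K.toCycles i j w = z := by
    apply (AddCommGrpCat.mono_iff_injective (K.iCycles j)).1 inferInstance
    rw [← h, ← K.toCycles_i i j]
    rfl
  rw [← hz, ← ConcreteCategory.comp_apply, K.toCycles_comp_homologyπ]
  rfl

variable {A : Type u} [AddCommGroup A] {Z : Type u} [AddCommGroup Z] (a : Z →+ K.X j) (b : Z →+ A)

/-- The homology of a complex of abelian groups, computed from a group `Z` surjecting onto the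
cycles. -/
structure HomologyPresentation where
  d_a (z : Z) (i : ι) : K.d j i (a z) = 0
  exists_a (x : K.X j) (hx : ∀ i, K.d j i x = 0) : ∃ z, a z = x
  b_surjective : Function.Surjective b
  b_eq_zero_iff (z : Z) : b z = 0 ↔ ∃ (i : ι) (w : K.X i), K.d i j w = a z

variable {K j a b} (h : HomologyPresentation K j a b)

namespace HomologyPresentation

include h in
lemma exists_lift (z : K.cycles j) : ∃ z', a z' = K.iCycles j z := by
  refine h.exists_a _ fun i => ?_
  rw [← ConcreteCategory.comp_apply, K.iCycles_d]
  rfl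

-- As `a` need not be injective, `b` has to be shown to depend on `a z` alone: a difference killed
-- by `a` is the boundary of `0`.
include h in
lemma b_eq {z z' : Z} (hz : a z = a z') : b z = b z' := by
  rw [← sub_eq_zero, ← map_sub, h.b_eq_zero_iff]
  exact ⟨j, 0, by rw [map_sub, hz, sub_self, map_zero]⟩

/-- The map from the cycles to the group presented by `Z`. -/
def fromCycles : K.cycles j ⟶ AddCommGrpCat.of A :=
  AddCommGrpCat.ofHom (AddMonoidHom.mk'
      (fun z : ToType (K.cycles j) => b (h.exists_lift z).choose) fun x y => by
    rw [← map_add]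
    refine h.b_eq ((h.exists_lift (x + y)).choose_spec.trans ?_)
    refine (map_add (K.iCycles j).hom x y).trans ?_
    rw [map_add, (h.exists_lift x).choose_spec,
      (h.exists_lift y).choose_spec]
    rfl)

lemma fromCycles_apply (z : K.cycles j) (z' : Z) (hz : a z' = K.iCycles j z) :
    h.fromCycles z = b z' :=
  h.b_eq ((h.exists_lift z).choose_spec.trans hz.symm)

/-- The map from the homology to the group presented by `Z`. -/
def desc : K.homology j ⟶ AddCommGrpCat.of A :=
  (K.homologyIsCokernel _ j rfl).desc (CokernelCofork.ofπ h.fromCycles (by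
    ext w
    obtain ⟨z, hz⟩ := h.exists_lift (K.toCycles (c.prev j) j w)
    refine (h.fromCycles_apply _ z hz).trans ((h.b_eq_zero_iff z).2 ⟨_, w, ?_⟩)
    rw [hz, ← ConcreteCategory.comp_apply, K.toCycles_i]))

lemma homologyπ_desc : K.homologyπ j ≫ h.desc = h.fromCycles :=
  (K.homologyIsCokernel _ j rfl).fac _ WalkingParallelPair.one

lemma desc_homologyπ (z : K.cycles j) (z' : Z) (hz : a z' = K.iCycles j z) :
    h.desc (K.homologyπ j z) = b z' := by
  rw [← ConcreteCategory.comp_apply, homologyπ_desc, h.fromCycles_apply z z' hz]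

lemma bijective_desc : Function.Bijective h.desc := by
  have hπ : Function.Surjective (K.homologyπ j) :=
    (AddCommGrpCat.epi_iff_surjective _).1 inferInstance
  constructor
  · rw [injective_iff_map_eq_zero]
    intro x hx
    obtain ⟨z, rfl⟩ := hπ x
    obtain ⟨z', hz'⟩ := h.exists_lift z
    rw [h.desc_homologyπ z z' hz', h.b_eq_zero_iff] at hx
    obtain ⟨i, w, hw⟩ := hx
    exact homologyπ_eq_zero_of_d_eq K j w z (hw.trans hz')
  · intro y
    obtain ⟨z', rfl⟩ := h.b_surjective y
    have hz' : a z' ∈ (K.iCycles j).hom.range := by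
      exact (ShortComplex.ab_exact_iff (ShortComplex.mk _ _ (K.iCycles_d j (c.next j)))).1
        (ShortComplex.exact_of_f_is_kernel _ (K.cyclesIsKernel j _ rfl)) (a z') (h.d_a z' _)
    obtain ⟨z, hz⟩ := hz'
    exact ⟨K.homologyπ j z, h.desc_homologyπ z z' hz.symm⟩

/-- The homology is isomorphic to the group presented by `Z`. -/
def iso : K.homology j ≅ AddCommGrpCat.of A :=
  have : IsIso h.desc := (ConcreteCategory.isIso_iff_bijective _).2 h.bijective_desc
  asIso h.desc

lemma iso_hom_homologyπ (z : K.cycles j) (z' : Z) (hz : a z' = K.iCycles j z) :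
    h.iso.hom (K.homologyπ j z) = b z' :=
  h.desc_homologyπ z z' hz

end HomologyPresentation

end

/-! ### Exact couples of abelian groups -/

/-- An exact couple of abelian groups formed by groups `T n q` and `G n q`, where the index `n` is
the total degree. -/
structure ExactCouple where
  /-- the groups of the tower -/
  T : ℤ → ℤ → Type u
  /-- the groups of the layers -/
  G : ℤ → ℤ → Type u
  [groupT (n q : ℤ) : AddCommGroup (T n q)]
  [groupG (n q : ℤ) : AddCommGroup (G n q)]
  /-- the maps of the tower -/
  i (n : ℤ) {q q' : ℤ} (h : q ≤ q') : T n q' →+ T n q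
  /-- the projections to the layers -/
  j (n q : ℤ) : T n q →+ G n q
  /-- the connecting maps -/
  δ (n n' q q' : ℤ) (hn : n' + 1 = n) (hq : q + 1 = q') : G n q →+ T n' q'
  i_refl (n q : ℤ) (x : T n q) : i n le_rfl x = x
  i_i (n : ℤ) {q q' q'' : ℤ} (h : q ≤ q') (h' : q' ≤ q'') (x : T n q'') :
    i n h (i n h' x) = i n (h.trans h') x
  j_eq_zero_iff (n : ℤ) {q q' : ℤ} (h : q ≤ q') (hq : q + 1 = q') (x : T n q) :
    j n q x = 0 ↔ ∃ y, i n h y = x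
  δ_eq_zero_iff (n n' q q' : ℤ) (hn : n' + 1 = n) (hq : q + 1 = q') (x : G n q) :
    δ n n' q q' hn hq x = 0 ↔ ∃ y, j n q y = x
  i_eq_zero_iff (n n' q q' : ℤ) (hn : n' + 1 = n) (hq : q + 1 = q') (h : q ≤ q') (x : T n' q') :
    i n' h x = 0 ↔ ∃ y, δ n n' q q' hn hq y = x

namespace ExactCouple

attribute [instance] groupT groupG

variable (C : ExactCouple.{u})

/-- The classes that survive to the page `2 + s`. -/
def Z (s : ℕ) (n q : ℤ) : AddSubgroup (C.G n q) :=
  (C.i (n - 1) (show q + 1 ≤ q + 1 + s by lia)).range.comap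
    (C.δ n (n - 1) q (q + 1) (by lia) rfl)

/-- The classes that vanish in the page `2 + s`. -/
def B (s : ℕ) (n q : ℤ) : AddSubgroup (C.G n q) :=
  (C.i n (show q - s ≤ q by lia)).ker.map (C.j n q)

variable {C}

/-- The indices are free variables tied by equations, so that later arguments need no transport
along equalities of degrees. -/
lemma mem_Z_iff {s : ℕ} {n q : ℤ} (x : C.G n q) {n' q' q'' : ℤ} (hn : n' + 1 = n) (hq : q + 1 = q')
    (hq' : q'' = q' + s) (h : q' ≤ q'') :
    x ∈ C.Z s n q ↔ ∃ y, C.i n' h y = C.δ n n' q q' hn hq x := by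
  obtain rfl : n' = n - 1 := by lia
  subst hq hq'
  rfl

lemma mem_B_iff {s : ℕ} {n q : ℤ} (x : C.G n q) {q' : ℤ} (hq : q' = q - s) (h : q' ≤ q) :
    x ∈ C.B s n q ↔ ∃ y, C.i n h y = 0 ∧ C.j n q y = x := by
  subst hq
  rfl

/-- Exactness gives `δ (j y) = 0`, which lifts arbitrarily far as `0`. Such classes are permanent
cycles. -/
lemma j_mem_Z (s : ℕ) (n q : ℤ) (y : C.T n q) : C.j n q y ∈ C.Z s n q := by
  rw [mem_Z_iff _ (sub_add_cancel n 1) rfl rfl (by lia)]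
  exact ⟨0, by rw [map_zero, eq_comm, C.δ_eq_zero_iff]; exact ⟨y, rfl⟩⟩

lemma Z_succ_le (s : ℕ) (n q : ℤ) : C.Z (s + 1) n q ≤ C.Z s n q := by
  intro x hx
  rw [mem_Z_iff _ (sub_add_cancel n 1) rfl rfl (by lia)] at hx ⊢
  obtain ⟨y, hy⟩ := hx
  exact ⟨C.i _ (by push_cast; lia) y, by rw [C.i_i, hy]⟩

lemma B_le_succ (s : ℕ) (n q : ℤ) : C.B s n q ≤ C.B (s + 1) n q := by
  intro x hx
  rw [mem_B_iff _ rfl (by lia)] at hx ⊢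
  obtain ⟨y, hy, rfl⟩ := hx
  refine ⟨y, ?_, rfl⟩
  rw [← C.i_i n (show q - (s + 1 : ℕ) ≤ q - s by push_cast; lia) (by lia), hy, map_zero]

variable (C) in
/-- The groups of the page `2 + s`. -/
abbrev E (s : ℕ) (n q : ℤ) : Type u := C.Z s n q ⧸ (C.B s n q).addSubgroupOf (C.Z s n q)

variable (C) in
/-- The projection from the classes that survive to the page `2 + s`. -/
def cls (s : ℕ) (n q : ℤ) : C.Z s n q →+ C.E s n q := QuotientAddGroup.mk' _

lemma cls_surjective (s : ℕ) (n q : ℤ) : Function.Surjective (C.cls s n q) :=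
  QuotientAddGroup.mk'_surjective _

lemma cls_eq_zero_iff (s : ℕ) (n q : ℤ) (x : C.Z s n q) : C.cls s n q x = 0 ↔ x.1 ∈ C.B s n q :=
  (QuotientAddGroup.eq_zero_iff x).trans AddSubgroup.mem_addSubgroupOf

/-- Two lifts with the same image differ by an element that dies `s` steps down the tower, so their
images under `j` differ by an element of `B`. This makes the differential independent of the lift.
-/
lemma cls_j_eq {s : ℕ} {n' q q' : ℤ} (hq : q' = q + s) (h : q ≤ q') (y y' : C.T n' q')
    (hy : C.i n' h y = C.i n' h y') :
    C.cls s n' q' ⟨C.j n' q' y, j_mem_Z _ _ _ _⟩ =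
      C.cls s n' q' ⟨C.j n' q' y', j_mem_Z _ _ _ _⟩ := by
  rw [← sub_eq_zero, ← map_sub, cls_eq_zero_iff, mem_B_iff _ (by lia) h]
  exact ⟨y - y', by rw [map_sub, hy, sub_self], by rw [map_sub]; rfl⟩

lemma exists_lift {s : ℕ} {n n' q q' : ℤ} (hn : n' + 1 = n) (hq : q' = q + 1 + s) (x : C.Z s n q) :
    ∃ y, C.i n' (show q + 1 ≤ q' by lia) y = C.δ n n' q (q + 1) hn rfl x.1 :=
  (mem_Z_iff x.1 hn rfl hq _).1 x.2

/-- The differential of the page `2 + s`, on the classes surviving to it. -/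
def dZ {s : ℕ} {n n' q q' : ℤ} (hn : n' + 1 = n) (hq : q' = q + 1 + s) :
    C.Z s n q →+ C.E s n' q' :=
  AddMonoidHom.mk' (fun x =>
      C.cls s n' q' ⟨C.j n' q' (exists_lift hn hq x).choose, j_mem_Z _ _ _ _⟩)
    fun x y => by
      rw [← map_add]
      refine Eq.trans (cls_j_eq hq (by lia) _
        ((exists_lift hn hq x).choose + (exists_lift hn hq y).choose) ?_) (congrArg _ ?_)
      · rw [(exists_lift hn hq (x + y)).choose_spec, map_add, (exists_lift hn hq x).choose_spec,
          (exists_lift hn hq y).choose_spec, ← map_add]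
        rfl
      · ext
        exact map_add _ _ _

lemma dZ_apply {s : ℕ} {n n' q q' : ℤ} (hn : n' + 1 = n) (hq : q' = q + 1 + s) (x : C.Z s n q)
    (y : C.T n' q') (hy : C.i n' (show q + 1 ≤ q' by lia) y = C.δ n n' q (q + 1) hn rfl x.1) :
    dZ hn hq x = C.cls s n' q' ⟨C.j n' q' y, j_mem_Z _ _ _ _⟩ :=
  cls_j_eq hq (by lia) _ _ ((exists_lift hn hq x).choose_spec.trans hy.symm)

lemma dZ_eq_zero_of_mem_B {s : ℕ} {n n' q q' : ℤ} (hn : n' + 1 = n) (hq : q' = q + 1 + s)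
    (x : C.Z s n q) (hx : x.1 ∈ C.B s n q) : dZ hn hq x = 0 := by
  obtain ⟨y, -, hy⟩ := (mem_B_iff x.1 rfl (by lia)).1 hx
  have h0 : C.δ n n' q (q + 1) hn rfl x.1 = 0 := (C.δ_eq_zero_iff _ _ _ _ _ _ _).2 ⟨y, hy⟩
  rw [dZ_apply hn hq x 0 (by rw [h0, map_zero]), cls_eq_zero_iff]
  simp only [map_zero]
  exact zero_mem _

/-- The differential of the page `2 + s`. -/
def dE {s : ℕ} {n n' q q' : ℤ} (hn : n' + 1 = n) (hq : q' = q + 1 + s) :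
    C.E s n q →+ C.E s n' q' :=
  QuotientAddGroup.lift _ (dZ hn hq) fun x hx =>
    dZ_eq_zero_of_mem_B hn hq x (AddSubgroup.mem_addSubgroupOf.1 hx)

lemma dE_cls {s : ℕ} {n n' q q' : ℤ} (hn : n' + 1 = n) (hq : q' = q + 1 + s) (x : C.Z s n q)
    (y : C.T n' q') (y' : C.Z s n' q')
    (hy : C.i n' (show q + 1 ≤ q' by lia) y = C.δ n n' q (q + 1) hn rfl x.1)
    (hy' : y'.1 = C.j n' q' y) : dE hn hq (C.cls s n q x) = C.cls s n' q' y' :=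
  (dZ_apply hn hq x y hy).trans (congrArg _ (Subtype.ext hy'.symm))

lemma dE_cls_j {s : ℕ} {n n' q q' : ℤ} (hn : n' + 1 = n) (hq : q' = q + 1 + s) (y : C.T n q) :
    dE hn hq (C.cls s n q ⟨C.j n q y, j_mem_Z _ _ _ _⟩) = 0 := by
  have h0 : C.δ n n' q (q + 1) hn rfl (C.j n q y) = 0 :=
    (C.δ_eq_zero_iff _ _ _ _ _ _ _).2 ⟨y, rfl⟩
  rw [dE_cls hn hq _ 0 0 (by rw [h0, map_zero]) (by rw [map_zero]; rfl), map_zero]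

/-- The values of a differential are classes `j y`, and these are permanent cycles. -/
lemma dE_dE {s : ℕ} {n n' n'' q q' q'' : ℤ} (hn : n' + 1 = n) (hq : q' = q + 1 + s)
    (hn' : n'' + 1 = n') (hq' : q'' = q' + 1 + s) (x : C.E s n q) :
    dE hn' hq' (dE hn hq x) = 0 := by
  obtain ⟨x, rfl⟩ := cls_surjective s n q x
  obtain ⟨y, hy⟩ := exists_lift hn hq x
  rw [dE_cls hn hq x y ⟨_, j_mem_Z _ _ _ y⟩ hy rfl, dE_cls_j]

/-- Let `y` lift `δ x`. If `j y` lies in `B`, then `j y = j w` with `w` dying in `T (q + 1)`. So `y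
- w` still lifts `δ x` and is killed by `j`, hence it lifts one step further. -/
lemma dE_cls_eq_zero_iff {s : ℕ} {n n' q q' : ℤ} (hn : n' + 1 = n) (hq : q' = q + 1 + s)
    (x : C.Z s n q) : dE hn hq (C.cls s n q x) = 0 ↔ x.1 ∈ C.Z (s + 1) n q := by
  obtain ⟨y, hy⟩ := exists_lift hn hq x
  rw [dE_cls hn hq x y ⟨_, j_mem_Z _ _ _ y⟩ hy rfl, cls_eq_zero_iff,
    mem_B_iff _ (show q + 1 = q' - s by lia) (by lia),
    mem_Z_iff x.1 hn rfl (show q' + 1 = _ by push_cast; lia) (by lia)]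
  constructor
  · rintro ⟨w, hw, hj⟩
    obtain ⟨z, hz⟩ := (C.j_eq_zero_iff n' (show q' ≤ q' + 1 by lia) rfl (y - w)).1
      (by rw [map_sub, hj, sub_self])
    refine ⟨z, ?_⟩
    rw [← C.i_i n' (show q + 1 ≤ q' by lia) (show q' ≤ q' + 1 by lia), hz, map_sub, hw,
      sub_zero, hy]
  · rintro ⟨z, hz⟩
    refine ⟨y - C.i n' (by lia) z, ?_, ?_⟩
    · rw [map_sub, C.i_i, hz, hy, sub_self]
    · rw [map_sub, (C.j_eq_zero_iff n' (show q' ≤ q' + 1 by lia) rfl _).2 ⟨z, rfl⟩, sub_zero]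

/-- A lift `y` of `δ v` dies in `T q`, because `i δ = 0`; this is one step further down than `B s`
allows. Conversely, if `y` dies in `T q`, then its image in `T (q + 1)` is some `δ v`, and `d [v] =
[j y]`. -/
lemma mem_range_dE_iff {s : ℕ} {n n' q q' : ℤ} (hn : n' + 1 = n) (hq : q' = q + 1 + s)
    (x : C.Z s n' q') : (∃ e, dE hn hq e = C.cls s n' q' x) ↔ x.1 ∈ C.B (s + 1) n' q' := by
  constructor
  · rintro ⟨e, he⟩
    obtain ⟨v, rfl⟩ := cls_surjective s n q e
    obtain ⟨y, hy⟩ := exists_lift hn hq v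
    rw [dE_cls hn hq v y ⟨_, j_mem_Z _ _ _ y⟩ hy rfl, eq_comm, ← sub_eq_zero, ← map_sub,
      cls_eq_zero_iff] at he
    have hj : C.j n' q' y ∈ C.B (s + 1) n' q' := by
      rw [mem_B_iff _ (show q = _ by push_cast; lia) (by lia)]
      refine ⟨y, ?_, rfl⟩
      rw [← C.i_i n' (show q ≤ q + 1 by lia) (by lia), hy, C.i_eq_zero_iff n n' q (q + 1) hn rfl]
      exact ⟨_, rfl⟩
    have := add_mem (B_le_succ s n' q' he) hj
    simpa using this
  · intro hx
    obtain ⟨y, hy, hj⟩ := (mem_B_iff _ (show q = _ by push_cast; lia) (by lia)).1 hx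
    rw [← C.i_i n' (show q ≤ q + 1 by lia) (by lia), C.i_eq_zero_iff n n' q (q + 1) hn rfl] at hy
    obtain ⟨v, hv⟩ := hy
    have hv' : v ∈ C.Z s n q := (mem_Z_iff v hn rfl hq (by lia)).2 ⟨y, hv.symm⟩
    exact ⟨C.cls s n q ⟨v, hv'⟩, dE_cls hn hq _ y x hv.symm hj.symm⟩

/-! ### The spectral sequence of an exact couple -/

variable (C) in
/-- The page `r` of the spectral sequence. -/
def page (r : ℤ) (hr : 2 ≤ r) :
    HomologicalComplex AddCommGrpCat.{u} (ComplexShape.up' ((-r, r - 1) : ℤ × ℤ)) where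
  -- Bidegree `(p, q)` has total degree `p + q` and tower index `q`; page `r` is the stage `s = r -
  -- 2`.
  X a := AddCommGrpCat.of (C.E (r - 2).toNat (a.1 + a.2) a.2)
  d a b := if h : b.1 = a.1 - r ∧ b.2 = a.2 + (r - 1) then
      AddCommGrpCat.ofHom (dE (by lia) (by lia)) else 0
  shape a b h := dif_neg fun h' => h (by ext <;> simp <;> lia)
  d_comp_d' a b c hab hbc := by
    simp only [ComplexShape.up', Prod.ext_iff, Prod.fst_add, Prod.snd_add] at hab hbc
    rw [dif_pos (by lia), dif_pos (by lia)]
    exact AddCommGrpCat.hom_ext (AddMonoidHom.ext fun x => dE_dE _ _ _ _ x)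

lemma page_d {r : ℤ} (hr : 2 ≤ r) (a b : ℤ × ℤ) (h : b.1 = a.1 - r ∧ b.2 = a.2 + (r - 1)) :
    (C.page r hr).d a b = AddCommGrpCat.ofHom (dE (by lia) (by lia)) := dif_pos h

variable (C) in
/-- The projection from `Z`, up to equalities of the indices. -/
def castCls {s s' : ℕ} {n n' q q' : ℤ} (hs : s = s') (hn : n = n') (hq : q = q') :
    C.Z s n q →+ C.E s' n' q' :=
  hs ▸ hn ▸ hq ▸ C.cls s n q

variable (C) in
/-- The class in the page `r` of an element of `Z`. -/
def pageCls (r : ℤ) (hr : 2 ≤ r) {s : ℕ} (hs : r = 2 + s) {n q p : ℤ} (hp : p = n - q) :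
    C.Z s n q →+ (C.page r hr).X (p, q) :=
  C.castCls (show s = (r - 2).toNat by lia) (show n = p + q by lia) rfl

section

variable {r : ℤ} (hr : 2 ≤ r) {s : ℕ} (hs : r = 2 + s) {n q p : ℤ} (hp : p = n - q)

lemma pageCls_surjective : Function.Surjective (C.pageCls r hr hs hp) := by
  have h1 : s = (r - 2).toNat := by lia
  have h2 : n = p + q := by lia
  subst h1 h2
  exact cls_surjective _ _ _

lemma pageCls_eq_zero_iff (x : C.Z s n q) : C.pageCls r hr hs hp x = 0 ↔ x.1 ∈ C.B s n q := by
  have h1 : s = (r - 2).toNat := by lia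
  have h2 : n = p + q := by lia
  subst h1 h2
  exact cls_eq_zero_iff _ _ _ _

lemma d_pageCls {n' q' p' : ℤ} (hn' : n' + 1 = n) (hp' : p' = n' - q') (hq' : q' = q + 1 + s)
    (x : C.Z s n q) (y : C.T n' q') (y' : C.Z s n' q')
    (hy : C.i n' (show q + 1 ≤ q' by lia) y = C.δ n n' q (q + 1) hn' rfl x.1)
    (hy' : y'.1 = C.j n' q' y) :
    (C.page r hr).d (p, q) (p', q') (C.pageCls r hr hs hp x) = C.pageCls r hr hs hp' y' := by
  have h1 : s = (r - 2).toNat := by lia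
  have h2 : n = p + q := by lia
  have h3 : n' = p' + q' := by lia
  subst h1 h2 h3
  have h : (p', q').1 = (p, q).1 - r ∧ (p', q').2 = (p, q).2 + (r - 1) := ⟨by lia, by lia⟩
  rw [page_d hr _ _ h]
  exact dE_cls _ hq' x y y' hy hy'

lemma d_pageCls_eq_zero_iff {n' q' p' : ℤ} (hn' : n' + 1 = n) (hp' : p' = n' - q')
    (hq' : q' = q + 1 + s) (x : C.Z s n q) :
    (C.page r hr).d (p, q) (p', q') (C.pageCls r hr hs hp x) = 0 ↔ x.1 ∈ C.Z (s + 1) n q := by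
  have h1 : s = (r - 2).toNat := by lia
  have h2 : n = p + q := by lia
  have h3 : n' = p' + q' := by lia
  subst h1 h2 h3
  have h : (p', q').1 = (p, q).1 - r ∧ (p', q').2 = (p, q).2 + (r - 1) := ⟨by lia, by lia⟩
  rw [page_d hr _ _ h]
  exact dE_cls_eq_zero_iff _ hq' x

end

lemma exists_d_eq_pageCls_iff {r : ℤ} (hr : 2 ≤ r) {s : ℕ} (hs : r = 2 + s) {n q p : ℤ}
    (hp : p = n - q) {n' q' p' : ℤ} (hn' : n' + 1 = n) (hp' : p' = n' - q')
    (hq' : q' = q + 1 + s) (x : C.Z s n' q') :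
    (∃ w, (C.page r hr).d (p, q) (p', q') w = C.pageCls r hr hs hp' x) ↔
      x.1 ∈ C.B (s + 1) n' q' := by
  have h1 : s = (r - 2).toNat := by lia
  have h2 : n = p + q := by lia
  have h3 : n' = p' + q' := by lia
  subst h1 h2 h3
  have h : (p', q').1 = (p, q).1 - r ∧ (p', q').2 = (p, q).2 + (r - 1) := ⟨by lia, by lia⟩
  rw [page_d hr _ _ h]
  exact mem_range_dE_iff _ hq' x

/-- The kernel computation says that `Z_{s+1}` surjects onto the cycles of page `r`, the image
computation that `B_{s+1}` is the preimage of the boundaries. So the homology is `Z_{s+1} /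
B_{s+1}`, the next page. -/
lemma homologyPresentation_page {r r' : ℤ} (hr : 2 ≤ r) (hr' : 2 ≤ r') (hrr' : r + 1 = r') {s : ℕ}
    (hs : r = 2 + s) {n q p : ℤ} (hp : p = n - q) :
    HomologyPresentation (C.page r hr) (p, q)
      ((C.pageCls r hr hs hp).comp (AddSubgroup.inclusion (Z_succ_le s n q)))
      (C.pageCls r' hr' (show r' = 2 + (s + 1 : ℕ) by push_cast; lia) hp) where
  d_a z a := by
    by_cases ha : a = (p - r, q + (r - 1))
    · subst ha
      exact (d_pageCls_eq_zero_iff hr hs hp (sub_add_cancel n 1) (by lia) (by lia) _).2 z.2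
    · rw [(C.page r hr).shape _ _ (fun h => ha (by rw [← h]; rfl))]
      rfl
  exists_a x hx := by
    obtain ⟨x, rfl⟩ := pageCls_surjective hr hs hp x
    have h := (d_pageCls_eq_zero_iff hr hs hp (sub_add_cancel n 1) (show p - r = _ by lia)
      (show q + (r - 1) = _ by lia) x).1 (hx _)
    exact ⟨⟨x.1, h⟩, rfl⟩
  b_surjective := pageCls_surjective _ _ _
  b_eq_zero_iff z := by
    rw [pageCls_eq_zero_iff]
    refine (exists_d_eq_pageCls_iff hr hs (show p + r = _ by lia) rfl hp
      (show q = q - (r - 1) + 1 + s by lia)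
      (AddSubgroup.inclusion (Z_succ_le s n q) z)).symm.trans ?_
    refine ⟨fun ⟨w, hw⟩ => ⟨_, w, hw⟩, fun ⟨a, w, hw⟩ => ?_⟩
    by_cases ha : a = (p + r, q - (r - 1))
    · subst ha
      exact ⟨w, hw⟩
    · rw [(C.page r hr).shape _ _ (fun h => ha (by
        simp only [ComplexShape.up', Prod.ext_iff, Prod.fst_add, Prod.snd_add] at h
        ext <;> simp <;> lia))] at hw
      exact ⟨0, by rw [map_zero]; exact hw⟩

variable (C) in
/-- The spectral sequence of an exact couple. -/
def spectralSequence : E2SpectralSequence.{u} where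
  page r hr := C.page r hr
  iso r r' a hrr' hr :=
    (homologyPresentation_page (C := C) hr (by lia) hrr' (show r = 2 + ((r - 2).toNat : ℕ) by lia)
      (show a.1 = a.1 + a.2 - a.2 by lia)).iso

lemma spectralSequence_iso_hom {r r' : ℤ} (hr : 2 ≤ r) (hrr' : r + 1 = r') {s s' : ℕ}
    (hs : r = 2 + s) (hs' : r' = 2 + s') {n q p : ℤ} (hp : p = n - q)
    (x : C.Z s n q) (x' : C.Z s' n q) (hx : x.1 = x'.1) (c : (C.page r hr).cycles (p, q))
    (hc : (C.page r hr).iCycles (p, q) c = C.pageCls r hr hs hp x) :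
    (C.spectralSequence.iso r r' (p, q) hrr' hr).hom ((C.page r hr).homologyπ (p, q) c) =
      C.pageCls r' (by lia) hs' hp x' := by
  obtain rfl : s = (r - 2).toNat := by lia
  obtain rfl : n = p + q := by lia
  obtain rfl : s' = (r - 2).toNat + 1 := by lia
  exact (homologyPresentation_page (C := C) hr (by lia) hrr' hs
    hp).iso_hom_homologyπ c x'
      ((congrArg (C.pageCls r hr hs hp) (Subtype.ext hx.symm)).trans hc.symm)

end ExactCouple

/-! ### The exact couple of a tower -/

namespace Tower

variable {T G : ℕ → DAb.{u}} (t : Tower T G)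

lemma i_refl (n : ℤ) (a : ℕ) (x : hD n (T a)) : t.i n (le_refl a) x = x := by
  have : t.trans (le_refl a) = 𝟙 _ := (Functor.ofOpSequence t.α).map_id _
  rw [i, this, CategoryTheory.Functor.map_id]
  rfl

lemma i_i (n : ℤ) {a b c : ℕ} (h : a ≤ b) (h' : b ≤ c) (x : hD n (T c)) :
    t.i n h (t.i n h' x) = t.i n (h.trans h') x := by
  have : t.trans (h.trans h') = t.trans h' ≫ t.trans h :=
    (Functor.ofOpSequence t.α).map_comp (homOfLE h').op (homOfLE h).op
  simp only [i, this, Functor.map_comp]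
  rfl

lemma i_succ (n : ℤ) (a : ℕ) (h : a ≤ a + 1) :
    t.i n h = (DerivedCategory.homologyFunctor _ (-n)).map (t.α a) :=
  congrArg _ (Functor.ofOpSequence_map_homOfLE_succ t.α a)

/-- The connecting homomorphism `Hₙ(G q) ⟶ Hₙ₋₁(T (q + 1))`. -/
def conn' (n n' : ℤ) (hn : n' + 1 = n) (q : ℕ) : hD n (G q) ⟶ hD n' (T (q + 1)) :=
  DerivedCategory.HomologySequence.δ
    (Pretriangulated.Triangle.mk (t.α q) (t.proj q) (t.conn q)) (-n) (-n') (by lia)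

lemma j_eq_zero_iff (n : ℤ) (q : ℕ) (h : q ≤ q + 1) (x : hD n (T q)) :
    t.j n q x = 0 ↔ ∃ y, t.i n h y = x := by
  have H := (ShortComplex.ab_exact_iff_function_exact _).1
    (DerivedCategory.HomologySequence.exact₂ _ (t.distinguished q) (-n))
  rw [i_succ]
  exact H x

lemma conn'_eq_zero_iff (n n' : ℤ) (hn : n' + 1 = n) (q : ℕ) (x : hD n (G q)) :
    t.conn' n n' hn q x = 0 ↔ ∃ y, t.j n q y = x :=
  (ShortComplex.ab_exact_iff_function_exact _).1
    (DerivedCategory.HomologySequence.exact₃ _ (t.distinguished q) (-n) (-n') (by lia)) x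

lemma i_eq_zero_iff (n n' : ℤ) (hn : n' + 1 = n) (q : ℕ) (h : q ≤ q + 1) (x : hD n' (T (q + 1))) :
    t.i n' h x = 0 ↔ ∃ y, t.conn' n n' hn q y = x := by
  have H := (ShortComplex.ab_exact_iff_function_exact _).1
    (DerivedCategory.HomologySequence.exact₁ _ (t.distinguished q) (-n) (-n') (by lia))
  rw [i_succ]
  exact H x

/-- Meant for the constant part of the extended tower, where the two indices are values of `toNat`
that are equal only propositionally. -/
lemma bijective_i (n : ℤ) {a b : ℕ} (h : a ≤ b) (h' : b ≤ a) : Function.Bijective (t.i n h) := by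
  obtain rfl := le_antisymm h h'
  have : ⇑(t.i n h) = id := funext fun x => t.i_refl n _ x
  rw [this]
  exact Function.bijective_id

variable (G) in
/-- The group `Hₙ(G q)` for `q ≥ 0`, and zero for `q < 0`. -/
def layerGroup (n : ℤ) : ℤ → Type u
  | .ofNat q => hD n (G q)
  | .negSucc _ => PUnit

instance (n q : ℤ) : AddCommGroup (layerGroup G n q) :=
  match q with
  | .ofNat q => inferInstanceAs (AddCommGroup (hD n (G q)))
  | .negSucc _ => inferInstanceAs (AddCommGroup PUnit)

/-- The exact couple of a tower, the tower being extended by `T q = T 0` and `G q = 0` for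
`q < 0`. -/
def exactCouple : ExactCouple.{u} where
  T n q := hD n (T q.toNat)
  G n q := layerGroup G n q
  i n _ _ h := (t.i n (Int.toNat_le_toNat h)).hom
  j n q :=
    match q with
    | .ofNat q => (t.j n q).hom
    | .negSucc _ => 0
  δ n n' q q' hn hq :=
    match q, q', hq with
    | .ofNat q, _, rfl => (t.conn' n n' hn q).hom
    | .negSucc _, _, _ => 0
  i_refl n q x := t.i_refl n _ x
  i_i n _ _ _ h h' x := t.i_i n _ _ x
  j_eq_zero_iff n q q' h hq x :=
    match q, q', hq with
    | .ofNat q, _, rfl => t.j_eq_zero_iff n q _ x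
    -- For `q < 0` also `q + 1 ≤ 0`: the transition map is an isomorphism between copies of `Hₙ(T
    -- 0)`, and the layer is zero.
    | .negSucc q, q', hq => ⟨fun _ => (t.bijective_i n _ (by lia)).2 x, fun _ => rfl⟩
  δ_eq_zero_iff n n' q q' hn hq x :=
    match q, q', hq with
    | .ofNat q, _, rfl => t.conn'_eq_zero_iff n n' hn q x
    | .negSucc q, q', hq => ⟨fun _ => ⟨0, rfl⟩, fun _ => rfl⟩
  i_eq_zero_iff n n' q q' hn hq h x :=
    match q, q', hq with
    | .ofNat q, _, rfl => t.i_eq_zero_iff n n' hn q _ x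
    | .negSucc q, q', hq => ⟨fun hx => ⟨0, ((t.bijective_i n' _ (by lia)).1
        (hx.trans (map_zero (t.i n' _).hom).symm)).symm⟩, by
        rintro ⟨y, rfl⟩
        exact map_zero (t.i n' _).hom⟩

end Tower

/-! ### Comparison with the spectral sequence of a tower, and convergence -/

/-- The isomorphism between two quotients of a group with the same kernel. -/
def equivOfSurjective {A B C : Type*} [AddCommGroup A] [AddCommGroup B] [AddCommGroup C]
    {f : A →+ B} {g : A →+ C} (hf : Function.Surjective f) (hg : Function.Surjective g)
    (h : ∀ a, f a = 0 ↔ g a = 0) : B ≃+ C :=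
  (QuotientAddGroup.quotientKerEquivOfSurjective f hf).symm.trans
    ((QuotientAddGroup.quotientAddEquivOfEq (show f.ker = g.ker from AddSubgroup.ext h)).trans
      (QuotientAddGroup.quotientKerEquivOfSurjective g hg))

lemma equivOfSurjective_apply {A B C : Type*} [AddCommGroup A] [AddCommGroup B] [AddCommGroup C]
    {f : A →+ B} {g : A →+ C} (hf : Function.Surjective f) (hg : Function.Surjective g)
    (h : ∀ a, f a = 0 ↔ g a = 0) (a : A) : equivOfSurjective hf hg h (f a) = g a := by
  have : (QuotientAddGroup.quotientKerEquivOfSurjective f hf).symm (f a) = QuotientAddGroup.mk a :=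
    (AddEquiv.symm_apply_eq _).2 rfl
  simp only [equivOfSurjective, AddEquiv.trans_apply, this]
  rfl

lemma ExactCouple.subsingleton_page (C : ExactCouple.{u}) {r : ℤ} (hr : 2 ≤ r) {n q p : ℤ}
    (hp : p = n - q) [Subsingleton (C.G n q)] : Subsingleton ((C.page r hr).X (p, q)) :=
  (ExactCouple.pageCls_surjective (C := C) hr (show r = 2 + ((r - 2).toNat : ℕ) by lia)
    hp).subsingleton

/-- Elements of `ker j` come from `T (q + 1)`, so `x` may be corrected by them. Once `T (q - s)` is
`T 0`, the condition says that the image of `x` lies in the next smaller step of the filtration. -/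
lemma ExactCouple.j_mem_B_iff {C : ExactCouple.{u}} (s : ℕ) (n q : ℤ) (x : C.T n q) :
    C.j n q x ∈ C.B s n q ↔ ∃ y : C.T n (q + 1),
      C.i n (show q - s ≤ q + 1 by lia) y = C.i n (show q - s ≤ q by lia) x := by
  rw [ExactCouple.mem_B_iff _ rfl (by lia)]
  constructor
  · rintro ⟨w, hw, hj⟩
    obtain ⟨y, hy⟩ := (C.j_eq_zero_iff n (show q ≤ q + 1 by lia) rfl (x - w)).1
      (by rw [map_sub, hj, sub_self])
    exact ⟨y, by rw [← C.i_i n (show q - s ≤ q by lia) (show q ≤ q + 1 by lia), hy, map_sub, hw,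
      sub_zero]⟩
  · rintro ⟨y, hy⟩
    refine ⟨x - C.i n (show q ≤ q + 1 by lia) y, ?_, ?_⟩
    · rw [map_sub, C.i_i, hy, sub_self]
    · rw [map_sub, (C.j_eq_zero_iff n (show q ≤ q + 1 by lia) rfl _).2 ⟨y, rfl⟩, sub_zero]

namespace Tower

variable {T G : ℕ → DAb.{u}} (t : Tower T G)

lemma mem_Z_iff (s : ℕ) (n : ℤ) (q : ℕ) (x : hD n (G q)) :
    x ∈ t.Z s n q ↔ x ∈ t.exactCouple.Z s n q := by
  refine Iff.trans (b := ∃ y : hD (n - 1) (T (q + 1 + s)),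
    t.i (n - 1) (Nat.le_add_right (q + 1) s) y = t.δ n q x) Iff.rfl ?_
  exact (ExactCouple.mem_Z_iff (C := t.exactCouple) (s := s) (n := n) (q := (q : ℤ))
    (n' := n - 1) (q' := ((q + 1 : ℕ) : ℤ)) (q'' := ((q + 1 + s : ℕ) : ℤ)) x (sub_add_cancel n 1)
    (by lia) (by lia) (by lia)).symm

/-- Truncated subtraction in `ℕ` and `toNat` of a difference in `ℤ` agree only propositionally; this
and the next lemma bridge the gap. -/
lemma i_eq_i_congr (n : ℤ) {a b c d : ℕ} (hab : a = b) (h : a ≤ c) (h' : b ≤ c) (k : a ≤ d)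
    (k' : b ≤ d) (x : hD n (T c)) (y : hD n (T d)) :
    t.i n h x = t.i n k y ↔ t.i n h' x = t.i n k' y := by
  subst hab
  rfl

lemma i_eq_zero_congr (n : ℤ) {a b c : ℕ} (hab : a = b) (h : a ≤ c) (h' : b ≤ c)
    (x : hD n (T c)) : t.i n h x = 0 ↔ t.i n h' x = 0 := by
  subst hab
  rfl

lemma mem_B_iff (s : ℕ) (n : ℤ) (q : ℕ) (x : hD n (G q)) :
    x ∈ t.B s n q ↔ x ∈ t.exactCouple.B s n q := by
  refine Iff.trans (exists_congr fun y => and_congr ?_ Iff.rfl)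
    (ExactCouple.mem_B_iff (C := t.exactCouple) (s := s) (n := n) (q := (q : ℤ)) x
      (show (q : ℤ) - s = _ from rfl) (by lia)).symm
  exact t.i_eq_zero_congr n (show q - s = ((q : ℤ) - s).toNat by lia) _
    (Int.toNat_le_toNat (show (q : ℤ) - s ≤ q by lia)) y

/-- The comparison of the classes surviving to the page `2 + s`. -/
def toZ (s : ℕ) (n : ℤ) (q : ℕ) : t.Z s n q →+ t.exactCouple.Z s n q where
  toFun x := ⟨x.1, (t.mem_Z_iff s n q x.1).1 x.2⟩
  map_zero' := rfl
  map_add' _ _ := rfl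

/-- The spectral sequence of the exact couple of a tower is the spectral sequence of the tower. -/
def spectralSequenceData : t.SpectralSequenceData t.exactCouple.spectralSequence where
  cls s n q := (t.exactCouple.pageCls (2 + s) (by lia) rfl rfl).comp (t.toZ s n q)
  cls_surjective s n q := (ExactCouple.pageCls_surjective (C := t.exactCouple) _ _ _).comp
    fun x => ⟨⟨x.1, (t.mem_Z_iff s n q x.1).2 x.2⟩, rfl⟩
  cls_eq_zero_iff s n q x :=
    (ExactCouple.pageCls_eq_zero_iff (C := t.exactCouple) _ _ _ _).trans
      (t.mem_B_iff s n q x.1).symm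
  d_cls s n q x y y' hy hy' :=
    ExactCouple.d_pageCls (C := t.exactCouple) (n := n) (q := (q : ℤ)) (n' := n - 1)
      (q' := ((q + 1 + s : ℕ) : ℤ)) (by lia) rfl rfl (sub_add_cancel n 1) rfl (by push_cast; rfl)
      (t.toZ s n q x) y (t.toZ s (n - 1) (q + 1 + s) y') hy hy'
  iso_cls s n q x x' hx c hc :=
    ExactCouple.spectralSequence_iso_hom (C := t.exactCouple) _ _ rfl rfl rfl _
      (t.toZ (s + 1) n q x') hx c hc

section

variable (hT : ∀ (n : ℤ) (q : ℕ), n < q → Subsingleton (hD n (T q)))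
  (hG : ∀ (n : ℤ) (q : ℕ), n < q → Subsingleton (hD n (G q)))

include hG in
lemma subsingleton_layerGroup (n q : ℤ) (h : n < q ∨ q < 0) : Subsingleton (layerGroup G n q) :=
  match q with
  | .ofNat q => hG n q (h.resolve_right (by simp))
  | .negSucc q => inferInstanceAs (Subsingleton PUnit)

-- For `s` at least `n.toNat + |q|`, the target has total degree `n - 1` and tower index `q + 1 + s
-- > n - 1`, so its layer has no homology there.
include hG in
lemma d_from_eq_zero (n q : ℤ) (s : ℕ) (hs : n.toNat + q.natAbs ≤ s) (b : ℤ × ℤ) :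
    (t.exactCouple.spectralSequence.page (2 + s)).d (n - q, q) b = 0 := by
  by_cases hb : b = (n - q - (2 + s), q + (2 + s - 1))
  · subst hb
    have : Subsingleton (t.exactCouple.G (n - 1) (q + (2 + s - 1))) :=
      subsingleton_layerGroup hG _ _ (by lia)
    have := t.exactCouple.subsingleton_page (show 2 ≤ 2 + (s : ℤ) by lia)
      (show n - q - (2 + s) = (n - 1) - (q + (2 + s - 1)) by lia)
    ext x
    exact Subsingleton.elim (α := (t.exactCouple.page (2 + s) _).X _) _ _
  · exact HomologicalComplex.shape _ _ _ fun h => hb (by rw [← h]; rfl)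

-- The source has tower index `q - 1 - s < 0`, where the layers of the extended tower are zero.
include hG in
lemma d_to_eq_zero (n q : ℤ) (s : ℕ) (hs : n.toNat + q.natAbs ≤ s) (b : ℤ × ℤ) :
    (t.exactCouple.spectralSequence.page (2 + s)).d b (n - q, q) = 0 := by
  by_cases hb : b = (n - q + (2 + s), q - (2 + s - 1))
  · subst hb
    have : Subsingleton (t.exactCouple.G (n + 1) (q - (2 + s - 1))) :=
      subsingleton_layerGroup hG _ _ (by lia)
    have := t.exactCouple.subsingleton_page (show 2 ≤ 2 + (s : ℤ) by lia)
      (show n - q + (2 + s) = (n + 1) - (q - (2 + s - 1)) by lia)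
    ext x
    exact (congrArg ((t.exactCouple.page (2 + s) _).d _ _).hom
      (Subsingleton.elim (α := (t.exactCouple.page (2 + s) _).X _) x 0)).trans (map_zero _)
  · refine HomologicalComplex.shape _ _ _ fun h => hb ?_
    simp only [ComplexShape.up', Prod.ext_iff, Prod.fst_add, Prod.snd_add] at h
    ext <;> simp <;> lia

/-- The map `Hₙ(T q) ⟶ Hₙ(T 0)`, where `T q` is understood as `T 0` for `q < 0`. -/
def iZero (n q : ℤ) : hD n (T q.toNat) →+ hD n (T 0) := (t.i n (Nat.zero_le q.toNat)).hom

variable {A : ℤ → AddCommGrpCat.{u}} (φ : ∀ n, hD n (T 0) ≅ A n)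

/-- The filtration of `A` by the images of the groups `Hₙ(T q)`. -/
def filt (n p : ℤ) : AddSubgroup (A n) := ((φ n).hom.hom.comp (t.iZero n (n - p))).range

lemma filt_sub (n q : ℤ) : t.filt φ n (n - q) = ((φ n).hom.hom.comp (t.iZero n q)).range := by
  rw [filt, sub_sub_cancel]

lemma filt_mono (n : ℤ) : Monotone (t.filt φ n) := by
  rintro p p' h _ ⟨x, rfl⟩
  have h' : (n - p').toNat ≤ (n - p).toNat := by lia
  exact ⟨t.i n h' x, congrArg (φ n).hom (t.i_i n _ h' x)⟩

/-- The map from `Hₙ(T q)` to the graded piece of the filtration. -/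
def toGr (n q : ℤ) : hD n (T q.toNat) →+
    (t.filt φ n (n - q) ⧸ (t.filt φ n (n - q - 1)).addSubgroupOf (t.filt φ n (n - q))) :=
  (QuotientAddGroup.mk' _).comp
    (((φ n).hom.hom.comp (t.iZero n q)).codRestrict _ fun x => by
      rw [filt_sub]
      exact ⟨x, rfl⟩)

lemma toGr_surjective (n q : ℤ) : Function.Surjective (t.toGr φ n q) := by
  intro y
  obtain ⟨⟨y, hy⟩, rfl⟩ := QuotientAddGroup.mk'_surjective _ y
  have hy' := hy
  rw [filt_sub] at hy'
  obtain ⟨x, rfl⟩ := hy'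
  exact ⟨x, rfl⟩

lemma toGr_eq_zero_iff (n q : ℤ) (x : hD n (T q.toNat)) :
    t.toGr φ n q x = 0 ↔ ∃ y : hD n (T (q + 1).toNat), t.iZero n (q + 1) y = t.iZero n q x := by
  refine (QuotientAddGroup.eq_zero_iff _).trans (AddSubgroup.mem_addSubgroupOf.trans ?_)
  rw [sub_sub, filt_sub]
  have hφ : Function.Injective (φ n).hom := (ConcreteCategory.bijective_of_isIso (φ n).hom).1
  exact exists_congr fun y => hφ.eq_iff

/-- The map from `Hₙ(T q)` to the page `2 + s`. -/
def toPage (s : ℕ) (n q : ℤ) :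
    hD n (T q.toNat) →+ (t.exactCouple.spectralSequence.page (2 + s)).X (n - q, q) :=
  (t.exactCouple.pageCls (2 + s) (by lia) rfl rfl).comp
    ((t.exactCouple.j n q).codRestrict (t.exactCouple.Z s n q) fun x => ExactCouple.j_mem_Z s n q x)

-- A lift of `δ x` lies in `Hₙ₋₁(T (q + 1 + s))`, which vanishes for large `s`. Hence `δ x = 0`, and
-- `x` comes from `Hₙ(T q)`.
include hT in
lemma toPage_surjective (s : ℕ) (n q : ℤ) (hs : n.toNat + q.natAbs ≤ s) :
    Function.Surjective (t.toPage s n q) := by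
  refine (ExactCouple.pageCls_surjective (C := t.exactCouple) _ _ _).comp fun x => ?_
  obtain ⟨y, hy⟩ := ExactCouple.exists_lift (sub_add_cancel n 1) rfl x
  have : Subsingleton (t.exactCouple.T (n - 1) (q + 1 + s)) :=
    hT (n - 1) (q + 1 + s).toNat (by lia)
  rw [Subsingleton.elim y 0, map_zero, eq_comm, t.exactCouple.δ_eq_zero_iff] at hy
  obtain ⟨z, hz⟩ := hy
  exact ⟨z, Subtype.ext hz⟩

lemma toPage_eq_zero_iff (s : ℕ) (n q : ℤ) (hs : n.toNat + q.natAbs ≤ s) (x : hD n (T q.toNat)) :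
    t.toPage s n q x = 0 ↔ ∃ y : hD n (T (q + 1).toNat), t.iZero n (q + 1) y = t.iZero n q x := by
  refine (ExactCouple.pageCls_eq_zero_iff (C := t.exactCouple) _ _ _ _).trans
    ((ExactCouple.j_mem_B_iff (C := t.exactCouple) s n q x).trans (exists_congr fun y => ?_))
  -- As `s ≥ |q|`, the group `T (q - s)` of the extended tower is `T 0`.
  exact t.i_eq_i_congr n (show (q - s).toNat = 0 by lia) _ _ _ _ _ _

/-- The spectral sequence of a tower converges strongly if `Hₙ(T q) = 0` and `Hₙ(G q) = 0` for
`n < q`. -/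
def strongConvergence : t.StrongConvergence t.spectralSequenceData A φ where
  filt := t.filt φ
  mono := t.filt_mono φ
  -- Tower index `n.toNat + 1` exceeds `n`, so `Hₙ` vanishes at that stage.
  exists_bot n := ⟨n - (n.toNat + 1 : ℕ), by
    rw [filt_sub, eq_bot_iff]
    rintro _ ⟨x, rfl⟩
    have : Subsingleton (hD n (T ((n.toNat + 1 : ℕ) : ℤ).toNat)) := hT n _ (by lia)
    rw [Subsingleton.elim x 0, map_zero]
    exact zero_mem _⟩
  exists_top n := ⟨n - 0, by
    rw [filt_sub, AddMonoidHom.range_eq_top]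
    exact (ConcreteCategory.bijective_of_isIso (φ n).hom).2.comp fun x => ⟨x, t.i_refl n 0 x⟩⟩
  stab n q := n.toNat + q.natAbs
  d_from n q s hs b := t.d_from_eq_zero hG n q s hs b
  d_to n q s hs b := t.d_to_eq_zero hG n q s hs b
  -- Both sides are quotients of `Hₙ(T q)` by the classes whose image in `Hₙ(T 0)` comes from `T (q
  -- + 1)`.
  gr n q := equivOfSurjective (t.toPage_surjective hT _ n q le_rfl) (t.toGr_surjective φ n q)
    fun x => (t.toPage_eq_zero_iff _ n q le_rfl x).trans (t.toGr_eq_zero_iff φ n q x).symm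
  filt_eq n q := t.filt_sub φ n q
  gr_cls n q z x hx a ha := by
    have hx' : t.spectralSequenceData.cls _ n q x = t.toPage _ n q z :=
      congrArg (t.exactCouple.pageCls (s := n.toNat + (q : ℤ).natAbs) (n := n) (q := (q : ℤ))
        (2 + (n.toNat + (q : ℤ).natAbs : ℕ)) (by lia) rfl rfl)
        (Subtype.ext (a1 := t.toZ _ n q x) (a2 := ⟨t.exactCouple.j n (q : ℤ) z,
          ExactCouple.j_mem_Z (C := t.exactCouple) _ n (q : ℤ) z⟩)
          hx)
    rw [hx', equivOfSurjective_apply]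
    exact congrArg (QuotientAddGroup.mk' _) (Subtype.ext ha.symm)

end

end Tower

/-! ### The distinguished triangles -/

section Triangles

open Pretriangulated

/-- In a distinguished triangle, the outer terms can be replaced by isomorphic ones, up to a sign of
the second map. -/
lemma exists_distinguished_of_iso {X Y Z X' : DAb.{u}} {f : X ⟶ Y} {g : Y ⟶ Z} {h : Z ⟶ X⟦(1 : ℤ)⟧}
    {ε : ℤˣ} (hT : Triangle.mk f (ε • g) h ∈ distinguishedTriangles) (e : X' ≅ X) :
    ∃ h', Triangle.mk (e.hom ≫ f) g h' ∈ distinguishedTriangles := by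
  have h₃ : (ε • (h ≫ (shiftFunctor DAb.{u} (1 : ℤ)).map e.inv)) ≫
      (shiftFunctor DAb.{u} (1 : ℤ)).map e.hom = (ε • 𝟙 Z) ≫ h := by
    rw [Linear.units_smul_comp, Linear.units_smul_comp, Category.assoc, ← Functor.map_comp,
      Iso.inv_hom_id, CategoryTheory.Functor.map_id, Category.comp_id, Category.id_comp]
  have hε : (ε • 𝟙 Z) ≫ (ε • 𝟙 Z) = 𝟙 Z := by
    rw [Linear.units_smul_comp, Category.id_comp, smul_smul, Int.units_mul_self, one_smul]
  have h₂ : g ≫ (ε • 𝟙 Z) = 𝟙 Y ≫ (ε • g) := by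
    rw [Linear.comp_units_smul, Category.comp_id, Category.id_comp]
  -- The automorphism `ε` of `Z` moves the sign from the second map to the connecting map.
  exact ⟨ε • (h ≫ (shiftFunctor DAb.{u} (1 : ℤ)).map e.inv), isomorphic_distinguished _ hT _
    (Triangle.isoMk _ _ e (Iso.refl _) ⟨ε • 𝟙 Z, ε • 𝟙 Z, hε, hε⟩ (Category.comp_id _) h₂ h₃)⟩

variable {K X Y C : Psh k} {ι : K ⟶ X} {f : X ⟶ Y} {π : Y ⟶ C} {w : ι ≫ f = 0} {w' : f ≫ π = 0}
  (h : (ShortComplex.mk ι f w).Exact) [Mono ι] (h' : (ShortComplex.mk f π w').Exact) [Epi π]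

include h h' in
/-- If `X(Δ̂•)` is acyclic, an exact sequence `0 ⟶ K ⟶ X ⟶ Y ⟶ C ⟶ 0` of presheaves defines a
distinguished triangle `K(Δ̂•)⟦1⟧ ⟶ Y(Δ̂•) ⟶ C(Δ̂•) ⟶ K(Δ̂•)⟦1⟧⟦1⟧`. -/
lemma exists_distinguished_of_isZero (hX : IsZero (toD.obj ((semilocalEval k).obj X))) :
    ∃ (α : (toD.obj ((semilocalEval k).obj K))⟦(1 : ℤ)⟧ ⟶ toD.obj ((semilocalEval k).obj Y))
      (γ : toD.obj ((semilocalEval k).obj C) ⟶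
        (toD.obj ((semilocalEval k).obj K))⟦(1 : ℤ)⟧⟦(1 : ℤ)⟧),
      Triangle.mk α (toD.map ((semilocalEval k).map π)) γ ∈ distinguishedTriangles := by
  -- The sequence is split at `ker π`, which is the image of `f`, into two short exact sequences.
  have w₁ : ι ≫ kernel.lift π f w' = 0 := by
    rw [← cancel_mono (kernel.ι π), Category.assoc, kernel.lift_ι, w, zero_comp]
  have hS₁ : (ShortComplex.mk ι (kernel.lift π f w') w₁).ShortExact :=
    { exact := (ShortComplex.exact_iff_of_epi_of_isIso_of_mono
          (S₁ := ShortComplex.mk ι (kernel.lift π f w') w₁) (S₂ := ShortComplex.mk ι f w)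
          { τ₁ := 𝟙 _, τ₂ := 𝟙 _, τ₃ := kernel.ι π }).2 h
      epi_g := h'.epi_kernelLift }
  have hS₂ : (ShortComplex.mk (kernel.ι π) π (kernel.condition π)).ShortExact :=
    { exact := ShortComplex.exact_kernel π }
  obtain ⟨δ₁, hδ₁⟩ := exists_distinguished hS₁
  obtain ⟨δ₂, hδ₂⟩ := exists_distinguished hS₂
  -- Since `X` evaluates to zero, `δ₁` identifies the evaluation of `ker π` with `K(Δ̂•)⟦1⟧`, which
  -- replaces it in the second triangle.
  have : IsIso δ₁ := (Triangle.isZero₂_iff_isIso₃ _ hδ₁).1 hX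
  have hδ₂' : Triangle.mk (toD.map ((semilocalEval k).map (kernel.ι π)))
      ((1 : ℤˣ) • toD.map ((semilocalEval k).map π)) δ₂ ∈ distinguishedTriangles := by
    rw [one_smul]
    exact hδ₂
  obtain ⟨γ, hγ⟩ := exists_distinguished_of_iso hδ₂' (asIso δ₁).symm
  exact ⟨_, γ, hγ⟩

include h h' in
/-- If `X(Δ̂•)` and `Y(Δ̂•)` are acyclic, an exact sequence `0 ⟶ K ⟶ X ⟶ Y ⟶ C ⟶ 0` of presheaves
defines an isomorphism `C(Δ̂•) ≅ K(Δ̂•)⟦2⟧`. -/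
lemma nonempty_iso_of_isZero (hX : IsZero (toD.obj ((semilocalEval k).obj X)))
    (hY : IsZero (toD.obj ((semilocalEval k).obj Y))) :
    Nonempty (toD.obj ((semilocalEval k).obj C) ≅
      (toD.obj ((semilocalEval k).obj K))⟦(2 : ℤ)⟧) := by
  obtain ⟨α, γ, hγ⟩ := exists_distinguished_of_isZero h h' hX
  have : IsIso γ := (Triangle.isZero₂_iff_isIso₃ _ hγ).1 hY
  exact ⟨asIso γ ≪≫ ((shiftFunctorAdd' DAb.{u} (1 : ℤ) 1 2 (by norm_num)).app _).symm⟩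

/-! ### The tower and the identification of `L(Δ̂•)` -/

/-- Followed by the monomorphism `F.iCycles j`, the second map is the differential, whose kernel is
the cycles. -/
lemma exact_iCycles_toCycles (F : CochainComplex (Psh k) ℤ) {i j : ℤ} (hij : i + 1 = j) :
    (ShortComplex.mk (F.iCycles i) (F.toCycles i j)
      (by rw [← cancel_mono (F.iCycles j), Category.assoc, F.toCycles_i, F.iCycles_d,
        zero_comp])).Exact :=
  (ShortComplex.exact_iff_of_epi_of_isIso_of_mono
      (S₁ := ShortComplex.mk (F.iCycles i) (F.toCycles i j)
        (by rw [← cancel_mono (F.iCycles j), Category.assoc, F.toCycles_i, F.iCycles_d, zero_comp]))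
      (S₂ := ShortComplex.mk (F.iCycles i) (F.d i j) (F.iCycles_d i j))
      { τ₁ := 𝟙 _, τ₂ := 𝟙 _, τ₃ := F.iCycles j }).2
    (ShortComplex.exact_of_f_is_kernel _ (F.cyclesIsKernel i j ((ComplexShape.up ℤ).next_eq' hij)))

lemma exact_toCycles_homologyπ (F : CochainComplex (Psh k) ℤ) {i j : ℤ} (hij : i + 1 = j) :
    (ShortComplex.mk (F.toCycles i j) (F.homologyπ j) (F.toCycles_comp_homologyπ i j)).Exact :=
  ShortComplex.exact_of_g_is_cokernel _
    (F.homologyIsCokernel i j ((ComplexShape.up ℤ).prev_eq' hij))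

/-- This is the triangle of `0 ⟶ K^{-q-2} ⟶ F^{-q-2} ⟶ K^{-q-1} ⟶ H^{-q-1} ⟶ 0`, shifted by `q`. -/
lemma nonempty_tower (F : CochainComplex (Psh k) ℤ)
    (hF : ∀ i : ℤ, i ≤ 0 → RationallyContractible (F.X i)) (q : ℕ) :
    ∃ (α : towerObj F (q + 1) ⟶ towerObj F q) (γ : layerObj F q ⟶ (towerObj F (q + 1))⟦(1 : ℤ)⟧),
      Triangle.mk α (towerProj F q) γ ∈ distinguishedTriangles := by
  have hij : -((q + 1 + 1 : ℕ) : ℤ) + 1 = -((q + 1 : ℕ) : ℤ) := by lia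
  obtain ⟨α, γ, hγ⟩ := exists_distinguished_of_isZero (exact_iCycles_toCycles F hij)
    (exact_toCycles_homologyπ F hij) (hF _ (by lia)).isZero_toD
  -- Shifting a triangle by `q` multiplies its maps by `(-1)^q`. The sign has to be removed from the
  -- projection, which is prescribed as `towerProj`; the first map is free and may keep it.
  exact ⟨_, exists_distinguished_of_iso (Triangle.shift_distinguished _ hγ (q : ℤ))
    ((shiftFunctorAdd' DAb.{u} (1 : ℤ) q ((q + 1 : ℕ) : ℤ) (by lia)).app _)⟩

/-- The tower `⋯ ⟶ K⁻³(Δ̂•)[-2] ⟶ K⁻²(Δ̂•)[-1] ⟶ K⁻¹(Δ̂•)`. -/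
def tower (F : CochainComplex (Psh k) ℤ)
    (hF : ∀ i : ℤ, i ≤ 0 → RationallyContractible (F.X i)) : Tower (towerObj F) (layerObj F) where
  α q := (nonempty_tower F hF q).choose
  proj q := towerProj F q
  conn q := (nonempty_tower F hF q).choose_spec.choose
  distinguished q := (nonempty_tower F hF q).choose_spec.choose_spec

/-- In `0 ⟶ K⁻¹ ⟶ F⁻¹ ⟶ F⁰ ⟶ L ⟶ 0` both middle terms evaluate to zero. -/
lemma nonempty_iso_cokerPsh (F : CochainComplex (Psh k) ℤ)
    (hF : ∀ i : ℤ, i ≤ 0 → RationallyContractible (F.X i)) :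
    Nonempty (toD.obj ((semilocalEval k).obj (cokerPsh F)) ≅
      (toD.obj ((semilocalEval k).obj (kerPsh F 1)))⟦(2 : ℤ)⟧) :=
  nonempty_iso_of_isZero
    (ShortComplex.exact_of_f_is_kernel (ShortComplex.mk _ _ (F.iCycles_d (-(1 : ℕ)) 0))
      (F.cyclesIsKernel (-(1 : ℕ)) 0 ((ComplexShape.up ℤ).next_eq' (by simp))))
    (ShortComplex.exact_cokernel (F.d (-1) 0)) (hF _ (by simp)).isZero_toD (hF _ le_rfl).isZero_toD

end Triangles

/-! ### Vanishing and the second page -/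

instance isLE_toD (A : ChainComplex AddCommGrpCat.{u} ℕ) : (toD.obj A).IsLE 0 := by
  refine (DerivedCategory.isLE_Q_obj_iff (toCochain.obj A) 0).2 ?_
  rw [CochainComplex.isLE_iff]
  intro i hi
  refine ShortComplex.exact_of_isZero_X₂ _
    (HomologicalComplex.isZero_extend_X A ComplexShape.embeddingDownNat i fun n hn => ?_)
  simp at hn
  lia

lemma isLE_toD_shift (A : ChainComplex AddCommGrpCat.{u} ℕ) (q : ℕ) :
    ((toD.obj A)⟦(q : ℤ)⟧).IsLE (-q) :=
  DerivedCategory.TStructure.t.isLE_shift _ 0 _ _ (by lia)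

/-- The shift by `q` moves homology into degrees at least `q`. Convergence rests on this vanishing,
for the stages and for the layers. -/
lemma subsingleton_hD (A : ChainComplex AddCommGrpCat.{u} ℕ) (n : ℤ) (q : ℕ) (h : n < q) :
    Subsingleton (hD n ((toD.obj A)⟦(q : ℤ)⟧)) :=
  have := isLE_toD_shift A q
  AddCommGrpCat.subsingleton_of_isZero
    (DerivedCategory.isZero_of_isLE _ (-(q : ℤ)) (-n) (by lia))

/-- The homology of a shift. -/
def hDShiftIso (A : ChainComplex AddCommGrpCat.{u} ℕ) {n p q : ℤ} (h : p = n - q) :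
    hD n ((toD.obj A)⟦q⟧) ≅ chainHomology A p :=
  ((DerivedCategory.homologyFunctor AddCommGrpCat.{u} 0).shiftIso q (-n) (-p) (by lia)).app
      (toD.obj A) ≪≫
    (DerivedCategory.homologyFunctorFactors _ (-p)).app (toCochain.obj A)

lemma isZero_chainHomology {A : Psh k} (hA : IsZero A) (p : ℤ) :
    IsZero (chainHomology ((semilocalEval k).obj A) p) :=
  (semilocalEval k ⋙ toCochain ⋙ HomologicalComplex.homologyFunctor _ _ (-p)).map_isZero hA

namespace ExactCouple

variable {C : ExactCouple.{u}}

/-- For `s = 0` the transition maps that define `Z` and `B` are identities, so `Z` is everything,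
`B` is zero, and `E²` is the layer itself. -/
lemma mem_Z_zero (n q : ℤ) (x : C.G n q) : x ∈ C.Z 0 n q :=
  (mem_Z_iff x (sub_add_cancel n 1) rfl (show q + 1 = q + 1 + (0 : ℕ) by simp) le_rfl).2
    ⟨_, C.i_refl _ _ _⟩

lemma mem_B_zero_iff (n q : ℤ) (x : C.G n q) : x ∈ C.B 0 n q ↔ x = 0 := by
  rw [mem_B_iff x (show q = q - (0 : ℕ) by simp) le_rfl]
  constructor
  · rintro ⟨y, hy, rfl⟩
    rw [C.i_refl] at hy
    rw [hy, map_zero]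
  · rintro rfl
    exact ⟨0, map_zero _, map_zero _⟩

/-- The second page. -/
def pageTwoEquiv {n q p : ℤ} (hp : p = n - q) : C.G n q ≃+ (C.page 2 le_rfl).X (p, q) :=
  AddEquiv.ofBijective ((C.pageCls 2 le_rfl (s := 0) (by simp) hp).comp
    ((AddMonoidHom.id _).codRestrict _ (mem_Z_zero n q))) (by
      constructor
      · rw [injective_iff_map_eq_zero]
        intro x hx
        exact (mem_B_zero_iff n q x).1 ((pageCls_eq_zero_iff _ _ _ _).1 hx)
      · exact (pageCls_surjective _ _ _).comp fun x => ⟨x.1, rfl⟩)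

end ExactCouple

/-- For `q ≥ 0` the degree `-1 - q` lies in the range where the truncation keeps the cohomology of
`F`. For `q < 0` the truncation has none, and the extended tower has zero layers. -/
lemma nonempty_pageTwo_iso (F : CochainComplex (Psh k) ℤ) (t : Tower (towerObj F) (layerObj F))
    (p q : ℤ) : Nonempty ((t.exactCouple.spectralSequence.page 2 le_rfl).X (p, q) ≅
      chainHomology ((semilocalEval k).obj ((F.truncLE (-1)).homology (-1 - q))) p) := by
  by_cases hq : 0 ≤ q
  · obtain ⟨q, rfl⟩ := Int.eq_ofNat_of_zero_le hq
    have := CochainComplex.quasiIsoAt_ιTruncLE F (-1) (-1 - q) (by lia)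
    have e : (F.truncLE (-1)).homology (-1 - q) ≅ cohPsh F (q + 1) :=
      asIso (HomologicalComplex.homologyMap (CochainComplex.ιTruncLE F (-1)) (-1 - q)) ≪≫
        eqToIso (congrArg (fun i : ℤ => F.homology i)
          (show -1 - (q : ℤ) = -((q + 1 : ℕ) : ℤ) by lia))
    exact ⟨(ExactCouple.pageTwoEquiv (C := t.exactCouple) (n := p + q) (q := (q : ℤ))
        (by lia)).symm.toAddCommGrpIso ≪≫
      hDShiftIso ((semilocalEval k).obj (cohPsh F (q + 1))) (n := p + q) (by lia) ≪≫
      (semilocalEval k ⋙ toCochain ⋙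
        HomologicalComplex.homologyFunctor _ _ (-p)).mapIso e.symm⟩
  · refine ⟨IsZero.iso ?_ (isZero_chainHomology
      (CochainComplex.isZero_of_isLE _ (-1) (-1 - q) (by lia)) p)⟩
    obtain ⟨q, rfl⟩ := Int.eq_negSucc_of_lt_zero (not_le.1 hq)
    have : Subsingleton (t.exactCouple.G (p + Int.negSucc q) (Int.negSucc q)) :=
      inferInstanceAs (Subsingleton PUnit)
    have : Subsingleton ((t.exactCouple.spectralSequence.page 2 le_rfl).X (p, Int.negSucc q)) :=
      t.exactCouple.subsingleton_page (n := p + Int.negSucc q) (q := Int.negSucc q) (p := p)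
        le_rfl (by lia)
    exact AddCommGrpCat.isZero_of_subsingleton _

end SemilocalEval

end

theorem theorem2p3 (k : Type u) [Field k] (F : CochainComplex (Psh k) ℤ)
    (hF : ∀ i : ℤ, 0 < i → IsZero (F.X i))
    (hrc : ∀ i : ℤ, i ≤ 0 → RationallyContractible (F.X i)) :
    ∃ (e : toD.obj ((semilocalEval k).obj (cokerPsh F)) ≅
        (toD.obj ((semilocalEval k).obj (kerPsh F 1)))⟦(2 : ℤ)⟧)
      (t : Tower (towerObj F) (layerObj F)),
      (∀ q, (towerObj F q).IsLE 0) ∧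
      (∀ q, t.proj q = towerProj F q) ∧
      ∃ (E : E2SpectralSequence.{u}) (D : t.SpectralSequenceData E),
        (∀ p q : ℤ, Nonempty ((E.page 2 le_rfl).X (p, q) ≅
          chainHomology ((semilocalEval k).obj ((F.truncLE (-1)).homology (-1 - q))) p)) ∧
        Nonempty (t.StrongConvergence D
          (fun n => chainHomology ((semilocalEval k).obj (cokerPsh F)) (n + 2))
          (abutmentIso F e)) := by
  obtain ⟨e⟩ := nonempty_iso_cokerPsh F hrc
  refine ⟨e, tower F hrc, fun q => ?_, fun q => rfl, _, (tower F hrc).spectralSequenceData,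
    nonempty_pageTwo_iso F _, ⟨(tower F hrc).strongConvergence
      (fun n q => subsingleton_hD _ n q) (fun n q => subsingleton_hD _ n q) _⟩⟩
  -- Stage `q` even lies in homological degrees at least `q`, which is weakened to degrees at least
  -- `0`.
  have : (towerObj F q).IsLE (-q) := isLE_toD_shift _ q
  exact DerivedCategory.TStructure.t.isLE_of_le _ (-(q : ℤ)) 0 (by lia)
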